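/- **Setting.** Let $(X,\omega)$ be a closed symplectic manifold of dimension $2n$ and $J$ an $\omega$-tame almost complex structure. Let $N\in\mathbb Z_{+}\cup\{\infty\}$ and let $L_v$ ($0\le v\le N$, $v$ finite) be connected embedded Lagrangian submanifolds of $X$ that intersect pairwise transversely. For a natural number $m<N$ put $L=\bigsqcup_{v=0}^{N}L_v$ and $L'=\bigsqcup_{v=0}^{m}L_v$, with the immersions $\iota_N:L\to X$ and $\iota_m:L'\to X$ given by the inclusions, and let $j:L'\to L$ be the inclusion. **Vertically discrete fc-multicategories.** Such an object consists of a directed graph $s,t:E\to V$ (0-cells $V$, horizontal 1-cells $E$; all vertical 1-cells are identities); sets $\mathcal M(e_1,\dots,e_k;e_0)$, $k\ge 0$, of 2-cells, one for each profile-loop, that is, for each edge $e_0$ and each composable path $(e_1,\dots,e_k)$ from $s(e_0)$ to $t(e_0)$; identity 2-cells $\mathrm{id}_e\in\mathcal M(e;e)$; and associative, unital partial compositions $\mathbf u\circ_i\mathbf u'$, defined when the $i$-th input edge of $\mathbf u$ is the output edge of $\mathbf u'$. An fc-submulticategory consists of subsets $V_0\subset V$, $E_0\subset E$, $\mathcal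 M_0\subset\mathcal M$ closed under all the structure maps. It is *full* if $\mathcal M_0(\vec e;e_0)=\mathcal M(\vec e;e_0)$ for every profile-loop with all edges in $E_0$, and *factor-closed* if $\mathbf u\circ_i\mathbf u'\in\mathcal M_0$ implies $\mathbf u\in\mathcal M_0$ and $\mathbf u'\in\mathcal M_0$. **The moduli fc-multicategory $\mathscr M_\iota$.** Let $\iota:L\to X$ be one of the above immersions. A *$J$-holomorphic stable polygon of type $k\ge 0$* is a tuple $\mathbf u=(\Sigma,z_0,\dots,z_k,u,\gamma)$ where $\Sigma$ is a connected nodal bordered Riemann surface of genus $0$ with connected non-empty boundary, i.e. a finite tree of discs and spheres, where two discs meet at boundary nodes and all other nodes are interior; $z_0,\dots,z_k\in\partial\Sigma$ are distinct, are not nodes, and are ordered along the boundary orientation; $u:\Sigma\to X$ is continuous and $J$-holomorphic on (the interior of) each component; $\gamma:\partial\Sigma\setminus\{z_0,\dots,z_k,\text{boundary nodes}\}\to L$ is continuous, satisfies $\iota\circ\gamma=u$, has one-sided limits at the marked points and boundary nodes, and extends continuously across each boundary node along paths that pass from one disc to the other respecting the boundary orientation; and the automorphism group of $\mathbf u$ is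 finite. Isomorphisms are biholomorphisms of the nodal surfaces that respect all the data. Writing $\gamma(z-)$ and $\gamma(z+)$ for the limits of $\gamma$ when $z$ is reached, respectively left, along the boundary orientation, put $\mathrm{ev}_0(\mathbf u)=(\gamma(z_0+),\gamma(z_0-))$ and $\mathrm{ev}_i(\mathbf u)=(\gamma(z_i-),\gamma(z_i+))$ for $1\le i\le k$; these are points of $L\times_X L$. Then $\mathscr M_\iota$ is the vertically discrete fc-multicategory with 0-cells $\pi_0(L)$; horizontal 1-cells $L\times_XL$, where $s,t$ send $(p,q)$ to the components of $p$ and of $q$; 2-cells in $\mathcal M(e_1,\dots,e_k;e_0)$ the isomorphism classes of stable polygons with $\mathrm{ev}_i=e_i$ for all $i$, together with, when $k=1$ and $e_1=e_0=e$, one formal identity 2-cell $\mathrm{id}_e$; and $\mathbf u\circ_i\mathbf u'$ given by gluing $z_i$ of $\mathbf u$ to $z_0$ of $\mathbf u'$ (into a boundary node). **Proposition.** The inclusion $j:L'\to L$ induces a map of fc-multicategories $F:\mathscr M_{\iota_m}\to\mathscr M_{\iota_N}$, which is $\pi_0(j)$ on 0-cells, $j\times j$ on 1-cells, and $[\Sigma,z_0,\dots,z_k,u,\gamma]\mapsto[\Sigma,z_0,\dots,z_k,u,j\circ\gamma]$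 on polygons. $F$ is injective on 0-cells, on 1-cells and on 2-cells, and its image is an fc-submulticategory of $\mathscr M_{\iota_N}$ that is full and factor-closed. -/

import Mathlib

open scoped Manifold ContDiff Topology

universe u v w

namespace FcModuli

/-! ### Vertically discrete fc-multicategories -/

/-- `IsEdgePath s t v l w`: the list `l` of edges of the directed graph `s, t : E → V` is a
composable path from the vertex `v` to the vertex `w` (the empty list is the empty path at `v = w`).
So `(l ; e)` is a profile-loop when `IsEdgePath s t (s e) l (t e)`. -/
def IsEdgePath {V : Type u} {E : Type v} (s t : E → V) : V → List E → V → Prop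
  | v, [], w => v = w
  | v, e :: l, w => s e = v ∧ IsEdgePath s t (t e) l w

/-- A vertically discrete fc-multicategory: a directed graph of 0-cells and horizontal 1-cells, a set
of 2-cells lying over profile-loops of this graph (all vertical 1-cells are identities), identity
2-cells, and associative and unital partial compositions `u ∘ᵢ u'`, which are defined when the
`i`-th input of `u` is the output of `u'`. Inputs are numbered from `0`. -/
structure VDFcMulticategory where
  /-- 0-cells -/
  V : Type u
  /-- horizontal 1-cells -/
  E : Type v
  /-- 2-cells -/
  Cell : Type w
  s : E → V
  t : E → V
  dom : Cell → List E
  cod : Cell → E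
  profile : ∀ a, IsEdgePath s t (s (cod a)) (dom a) (t (cod a))
  unit : E → Cell
  dom_unit : ∀ e, dom (unit e) = [e]
  cod_unit : ∀ e, cod (unit e) = e
  comp : (a : Cell) → (i : ℕ) → (b : Cell) → (dom a)[i]? = some (cod b) → Cell
  dom_comp : ∀ a i b h, dom (comp a i b h) = (dom a).take i ++ dom b ++ (dom a).drop (i + 1)
  cod_comp : ∀ a i b h, cod (comp a i b h) = cod a
  unit_comp : ∀ e b h, comp (unit e) 0 b h = b
  comp_unit : ∀ a i e h, comp a i (unit e) h = a
  assoc : ∀ a i b j c h₁ h₂ h₃ h₄,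
    comp (comp a i b h₁) (i + j) c h₃ = comp a i (comp b j c h₂) h₄
  comm : ∀ a i b k c h₁ h₂ h₃ h₄, i ≤ k →
    comp (comp a i b h₁) (k + (dom b).length) c h₃ = comp (comp a (k + 1) c h₂) i b h₄

/-- Maps of (vertically discrete) fc-multicategories. -/
structure FcMap (M M' : VDFcMulticategory.{u, v, w}) where
  onV : M.V → M'.V
  onE : M.E → M'.E
  onCell : M.Cell → M'.Cell
  map_s : ∀ e, M'.s (onE e) = onV (M.s e)
  map_t : ∀ e, M'.t (onE e) = onV (M.t e)
  map_dom : ∀ a, M'.dom (onCell a) = (M.dom a).map onE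
  map_cod : ∀ a, M'.cod (onCell a) = onE (M.cod a)
  map_unit : ∀ e, onCell (M.unit e) = M'.unit (onE e)
  map_comp : ∀ a i b h h', onCell (M.comp a i b h) = M'.comp (onCell a) i (onCell b) h'

/-- fc-submulticategories: subsets of the 0-cells, 1-cells and 2-cells to which the structure maps
restrict. -/
structure FcSub (M : VDFcMulticategory.{u, v, w}) where
  V₀ : Set M.V
  E₀ : Set M.E
  Cell₀ : Set M.Cell
  s_mem : ∀ e ∈ E₀, M.s e ∈ V₀
  t_mem : ∀ e ∈ E₀, M.t e ∈ V₀
  dom_mem : ∀ a ∈ Cell₀, ∀ e ∈ M.dom a, e ∈ E₀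
  cod_mem : ∀ a ∈ Cell₀, M.cod a ∈ E₀
  unit_mem : ∀ e ∈ E₀, M.unit e ∈ Cell₀
  comp_mem : ∀ a i b h, a ∈ Cell₀ → b ∈ Cell₀ → M.comp a i b h ∈ Cell₀

/-- Fullness: every 2-cell of `M` over a profile-loop in `E₀` belongs to the fc-submulticategory. -/
def FcSub.IsFull {M : VDFcMulticategory.{u, v, w}} (S : FcSub M) : Prop :=
  ∀ a, (∀ e ∈ M.dom a, e ∈ S.E₀) → M.cod a ∈ S.E₀ → a ∈ S.Cell₀

/-- Factor-closedness: if a partial composite lies in the fc-submulticategory, so do both factors. -/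
def FcSub.IsFactorClosed {M : VDFcMulticategory.{u, v, w}} (S : FcSub M) : Prop :=
  ∀ a i b h, M.comp a i b h ∈ S.Cell₀ → a ∈ S.Cell₀ ∧ b ∈ S.Cell₀

/-! ### Symplectic manifolds, almost complex structures, Lagrangian submanifolds -/

section Symplectic

variable {d : ℕ} (X : Type u) [TopologicalSpace X] [ChartedSpace (EuclideanSpace ℝ (Fin d)) X]

/-- A symplectic form on `X`: a smooth, alternating, nondegenerate and closed 2-form. Closedness is
expressed in the charts `φ = chartAt x₀`, where the form has the coefficients
`y ↦ Ω (φ⁻¹ y) (dφ⁻¹ a) (dφ⁻¹ b)`. -/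
structure SymplecticForm [IsManifold (𝓡 d) ∞ X] where
  form : ∀ x : X, TangentSpace (𝓡 d) x →L[ℝ] TangentSpace (𝓡 d) x →L[ℝ] ℝ
  smooth : ContMDiff (𝓡 d) ((𝓡 d).prod
      𝓘(ℝ, EuclideanSpace ℝ (Fin d) →L[ℝ] EuclideanSpace ℝ (Fin d) →L[ℝ] ℝ)) ∞
    (fun x => Bundle.TotalSpace.mk'
      (EuclideanSpace ℝ (Fin d) →L[ℝ] EuclideanSpace ℝ (Fin d) →L[ℝ] ℝ)
      (E := fun x : X => TangentSpace (𝓡 d) x →L[ℝ] TangentSpace (𝓡 d) x →L[ℝ] ℝ) x (form x))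
  alt : ∀ x a, form x a a = 0
  nondegenerate : ∀ x a, (∀ b, form x a b = 0) → a = 0
  closed : ∀ x₀ : X, ∀ y ∈ (chartAt (EuclideanSpace ℝ (Fin d)) x₀).target,
    ∀ a b c : EuclideanSpace ℝ (Fin d),
      let φ := (chartAt (EuclideanSpace ℝ (Fin d)) x₀).symm
      let η : EuclideanSpace ℝ (Fin d) → EuclideanSpace ℝ (Fin d) →
          EuclideanSpace ℝ (Fin d) → ℝ := fun p q y =>
        form (φ y) (mfderiv (𝓡 d) (𝓡 d) φ y p) (mfderiv (𝓡 d) (𝓡 d) φ y q)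
      fderiv ℝ (η b c) y a + fderiv ℝ (η c a) y b + fderiv ℝ (η a b) y c = 0

/-- A smooth almost complex structure on `X`. -/
structure AlmostComplexStructure [IsManifold (𝓡 d) ∞ X] where
  J : ∀ x : X, TangentSpace (𝓡 d) x →L[ℝ] TangentSpace (𝓡 d) x
  smooth : ContMDiff (𝓡 d) ((𝓡 d).prod
      𝓘(ℝ, EuclideanSpace ℝ (Fin d) →L[ℝ] EuclideanSpace ℝ (Fin d))) ∞
    (fun x => Bundle.TotalSpace.mk'
      (EuclideanSpace ℝ (Fin d) →L[ℝ] EuclideanSpace ℝ (Fin d))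
      (E := fun x : X => TangentSpace (𝓡 d) x →L[ℝ] TangentSpace (𝓡 d) x) x (J x))
  sq : ∀ x a, J x (J x a) = -a

variable {X}
variable [IsManifold (𝓡 d) ∞ X]

/-- `J` is `Ω`-tame: `Ω (a, J a) > 0` for every nonzero tangent vector `a`. -/
def AlmostComplexStructure.IsTame (J : AlmostComplexStructure (d := d) X)
    (Ω : SymplecticForm (d := d) X) : Prop :=
  ∀ x a, a ≠ 0 → 0 < Ω.form x a (J.J x a)

/-- Embedded smooth `k`-dimensional submanifolds, through slice charts. -/
def IsEmbeddedSubmanifold (d k : ℕ) {X : Type u} [TopologicalSpace X]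
    [ChartedSpace (EuclideanSpace ℝ (Fin d)) X] (S : Set X) : Prop :=
  ∀ p ∈ S, ∃ φ ∈ IsManifold.maximalAtlas (𝓡 d) ∞ X, p ∈ φ.source ∧
    ∃ W : Submodule ℝ (EuclideanSpace ℝ (Fin d)), Module.finrank ℝ W = k ∧
      ∀ q ∈ φ.source, q ∈ S ↔ φ q - φ p ∈ W

/-- The tangent vectors of a submanifold `S` at `p`: velocities of smooth curves in `S`. -/
def tangentsTo (d : ℕ) {X : Type u} [TopologicalSpace X]
    [ChartedSpace (EuclideanSpace ℝ (Fin d)) X] (S : Set X) (p : X) :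
    Set (TangentSpace (𝓡 d) p) :=
  {a | ∃ c : ℝ → X, ∃ h : c 0 = p, ContMDiffAt 𝓘(ℝ, ℝ) (𝓡 d) ∞ c 0 ∧ (∀ᶠ r in 𝓝 0, c r ∈ S) ∧
    h ▸ (mfderiv 𝓘(ℝ, ℝ) (𝓡 d) c 0 (1 : ℝ) : TangentSpace (𝓡 d) (c 0)) = a}

/-- Embedded Lagrangian submanifolds of a symplectic manifold of dimension `2 * n`. -/
def SymplecticForm.IsLagrangian {n : ℕ} {X : Type u} [TopologicalSpace X]
    [ChartedSpace (EuclideanSpace ℝ (Fin (2 * n))) X] [IsManifold (𝓡 (2 * n)) ∞ X]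
    (Ω : SymplecticForm (d := 2 * n) X) (S : Set X) : Prop :=
  IsEmbeddedSubmanifold (2 * n) n S ∧
    ∀ p ∈ S, ∀ a ∈ tangentsTo (2 * n) S p, ∀ b ∈ tangentsTo (2 * n) S p, Ω.form p a b = 0

/-- Two submanifolds intersect transversely: their tangent spaces span at all common points. -/
def Transverse (d : ℕ) {X : Type u} [TopologicalSpace X]
    [ChartedSpace (EuclideanSpace ℝ (Fin d)) X] (S S' : Set X) : Prop :=
  ∀ p ∈ S ∩ S', ∀ a : TangentSpace (𝓡 d) p,
    ∃ b ∈ tangentsTo d S p, ∃ c ∈ tangentsTo d S' p, a = b + c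

/-- `f` is smooth near `z` and `df ∘ i = J ∘ df` at `z`. -/
def AlmostComplexStructure.IsHolomorphicAt (J : AlmostComplexStructure (d := d) X)
    (f : ℂ → X) (z : ℂ) : Prop :=
  ContMDiffAt 𝓘(ℝ, ℂ) (𝓡 d) ∞ f z ∧
    ∀ a : ℂ, (mfderiv 𝓘(ℝ, ℂ) (𝓡 d) f z : ℂ →L[ℝ] TangentSpace (𝓡 d) (f z)) (Complex.I * a) =
      J.J (f z) ((mfderiv 𝓘(ℝ, ℂ) (𝓡 d) f z : ℂ →L[ℝ] TangentSpace (𝓡 d) (f z)) a)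

end Symplectic


/-! ### Pseudo-holomorphic polygons

Components of a nodal surface are copies of the Riemann sphere `OnePoint ℂ` or of the closed unit disc
in it. -/

/-- The point of the boundary of the unit disc given by `z : Circle`, on the Riemann sphere. -/
def bpt (z : Circle) : OnePoint ℂ := ((z : ℂ) : OnePoint ℂ)

/-- The closed unit disc. -/
def closedDisc : Set (OnePoint ℂ) := {p | ∃ z : ℂ, ‖z‖ ≤ 1 ∧ p = (z : OnePoint ℂ)}

/-- The open unit disc. -/
def openDisc : Set (OnePoint ℂ) := {p | ∃ z : ℂ, ‖z‖ < 1 ∧ p = (z : OnePoint ℂ)}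

/-- The affine coordinate `w ↦ 1 / w` of the Riemann sphere near `∞`. -/
noncomputable def coordInfty (w : ℂ) : OnePoint ℂ := if w = 0 then OnePoint.infty else ((w⁻¹ : ℂ))

/-- The data of a nodal surface of genus `0` whose components are discs and spheres, with boundary
marked points `z₀ = out` and `(z₁, …, z_k) = inputs`, a map `u` to `X` and a lift `γ` of the boundary
values of `u` to `L`. The surface is the quotient of the disjoint union of the components by
`node α β ∼ node β α` for `α`, `β` adjacent in `G`. The lift, which is not defined at special points,
is recorded through its one-sided limits `liftIn` (arriving at a point along the boundary
orientation) and `liftOut` (leaving the point along the boundary orientation).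
Values outside the meaningful domain (such as `node α β` for `α`, `β` not adjacent) are irrelevant. -/
structure PolygonData (X : Type u) (L : Type v) where
  /-- the components -/
  C : Type
  /-- the components that are discs; the others are spheres -/
  disc : Set C
  /-- adjacency: the components that share a node -/
  G : SimpleGraph C
  /-- the point of the component `α` at which the component `β` is attached -/
  node : C → C → OnePoint ℂ
  out : C × Circle
  inputs : List (C × Circle)
  map : C → OnePoint ℂ → X
  liftIn : C → Circle → L
  liftOut : C → Circle → L

namespace PolygonData

variable {X : Type u} {L : Type v}

/-- The component `α` as a subset of the Riemann sphere. -/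
def domain (D : PolygonData X L) (α : D.C) : Set (OnePoint ℂ) :=
  {z | α ∈ D.disc → z ∈ closedDisc}

/-- The interior of the component `α`. -/
def inner (D : PolygonData X L) (α : D.C) : Set (OnePoint ℂ) :=
  {z | α ∈ D.disc → z ∈ openDisc}

/-- The special points of the component `α`: its nodes and marked points. -/
def special (D : PolygonData X L) (α : D.C) : Set (OnePoint ℂ) :=
  {z | (∃ β, D.G.Adj α β ∧ z = D.node α β) ∨ ∃ p ∈ D.out :: D.inputs, p.1 = α ∧ z = bpt p.2}

/-- `q` is the first special point met when one leaves `p` along the boundary of its disc,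
counterclockwise. -/
def Next (D : PolygonData X L) (p q : D.C × Circle) : Prop :=
  q.1 = p.1 ∧ bpt q.2 ∈ D.special q.1 ∧
    ∃ θ ∈ Set.Ioc 0 (2 * Real.pi), q.2 = Circle.exp θ * p.2 ∧
      ∀ θ' ∈ Set.Ioo 0 θ, bpt (Circle.exp θ' * p.2) ∉ D.special p.1

/-- `p` and `q` are the two preimages of a boundary node. -/
def Glued (D : PolygonData X L) (p q : D.C × Circle) : Prop :=
  D.G.Adj p.1 q.1 ∧ bpt p.2 = D.node p.1 q.1 ∧ bpt q.2 = D.node q.1 p.1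

/-- `q` is the special point that follows `p` when one traverses the boundary of the nodal surface:
at a marked point one continues on the same disc, at a node one passes to the other disc. -/
def Step (D : PolygonData X L) (p q : D.C × Circle) : Prop :=
  (p ∈ D.out :: D.inputs ∧ D.Next p q) ∨ ∃ p', D.Glued p p' ∧ D.Next p' q

/-- Isomorphisms: biholomorphic identifications (Möbius transformations) of the components that
match all the data. -/
structure Iso (D D' : PolygonData X L) where
  f : D.C ≃ D'.C
  φ : D.C → Equiv.Perm (OnePoint ℂ)
  moebius : ∀ α, ∃ g : GL (Fin 2) ℂ, ∀ z, φ α z = g • z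
  disc_iff : ∀ α, f α ∈ D'.disc ↔ α ∈ D.disc
  image_domain : ∀ α, φ α '' D.domain α = D'.domain (f α)
  image_inner : ∀ α, φ α '' D.inner α = D'.inner (f α)
  adj_iff : ∀ α β, D'.G.Adj (f α) (f β) ↔ D.G.Adj α β
  node_eq : ∀ α β, D.G.Adj α β → D'.node (f α) (f β) = φ α (D.node α β)
  out_eq : D'.out.1 = f D.out.1 ∧ bpt D'.out.2 = φ D.out.1 (bpt D.out.2)
  inputs_eq : List.Forall₂ (fun p p' => p'.1 = f p.1 ∧ bpt p'.2 = φ p.1 (bpt p.2))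
    D.inputs D'.inputs
  map_eq : ∀ α, ∀ z ∈ D.domain α, D'.map (f α) (φ α z) = D.map α z
  lift_eq : ∀ α ∈ D.disc, ∀ z z' : Circle, bpt z' = φ α (bpt z) →
    D'.liftIn (f α) z' = D.liftIn α z ∧ D'.liftOut (f α) z' = D.liftOut α z

variable [TopologicalSpace X] [TopologicalSpace L] {d : ℕ}
  [ChartedSpace (EuclideanSpace ℝ (Fin d)) X] [IsManifold (𝓡 d) ∞ X]

/-- `D` is a `J`-holomorphic stable polygon with boundary on `ι : L → X`. -/
structure IsStable (J : AlmostComplexStructure (d := d) X) (ι : L → X)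
    (D : PolygonData X L) : Prop where
  finite : Finite D.C
  tree : D.G.IsTree
  out_disc : D.out.1 ∈ D.disc
  inputs_disc : ∀ p ∈ D.inputs, p.1 ∈ D.disc
  /-- two discs meet at boundary points -/
  node_bdry : ∀ α β, D.G.Adj α β → α ∈ D.disc → β ∈ D.disc → ∃ z, D.node α β = bpt z
  /-- all other nodes are interior -/
  node_inner : ∀ α β, D.G.Adj α β → ¬ (α ∈ D.disc ∧ β ∈ D.disc) → D.node α β ∈ D.inner α
  /-- the special points of a component are distinct -/
  node_inj : ∀ α β β', D.G.Adj α β → D.G.Adj α β' → D.node α β = D.node α β' → β = β'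
  marked_nodup : (D.out :: D.inputs).Nodup
  marked_ne_node : ∀ p ∈ D.out :: D.inputs, ∀ β, D.G.Adj p.1 β → bpt p.2 ≠ D.node p.1 β
  /-- the boundary is connected: every disc has a special point on its boundary, and all of these
  points are met, with the marked points in their order, when the boundary is traversed once -/
  bdry_special : ∀ α ∈ D.disc, ∃ z, bpt z ∈ D.special α
  order : ∃ l : List (D.C × Circle), (D.out :: l).Nodup ∧
    (∀ p, p ∈ D.out :: l ↔ p.1 ∈ D.disc ∧ bpt p.2 ∈ D.special p.1) ∧
    List.IsChain D.Step (D.out :: l ++ [D.out]) ∧ D.inputs.Sublist l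
  continuous : ∀ α, ContinuousOn (D.map α) (D.domain α)
  holomorphic : ∀ α, ∀ z : ℂ, (z : OnePoint ℂ) ∈ D.inner α →
    J.IsHolomorphicAt (fun w : ℂ => D.map α (w : OnePoint ℂ)) z
  holomorphic_infty : ∀ α, α ∉ D.disc → J.IsHolomorphicAt (fun w => D.map α (coordInfty w)) 0
  map_node : ∀ α β, D.G.Adj α β → D.map α (D.node α β) = D.map β (D.node β α)
  lift_map : ∀ α ∈ D.disc, ∀ z,
    ι (D.liftIn α z) = D.map α (bpt z) ∧ ι (D.liftOut α z) = D.map α (bpt z)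
  /-- away from the special points the lift is an unambiguous function -/
  lift_eq : ∀ α ∈ D.disc, ∀ z, bpt z ∉ D.special α → D.liftIn α z = D.liftOut α z
  /-- `liftIn` and `liftOut` are the one-sided limits of the lift; in particular the lift is
  continuous away from the special points -/
  lift_tendsto : ∀ α ∈ D.disc, ∀ z,
    Filter.Tendsto (fun θ : ℝ => D.liftIn α (Circle.exp θ * z)) (𝓝[<] 0) (𝓝 (D.liftIn α z)) ∧
    Filter.Tendsto (fun θ : ℝ => D.liftOut α (Circle.exp θ * z)) (𝓝[>] 0) (𝓝 (D.liftOut α z))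
  /-- relative continuity of the lift at the boundary nodes -/
  lift_node : ∀ p q, D.Glued p q → p.1 ∈ D.disc → q.1 ∈ D.disc →
    D.liftIn p.1 p.2 = D.liftOut q.1 q.2
  /-- stability: the automorphism group is finite -/
  stable : Finite (D.Iso D)

/-- Gluing of the point `z₀` of `B` to the `i`-th input of `A`. -/
@[reducible] def glue (A : PolygonData X L) (i : ℕ) (hi : i < A.inputs.length) (B : PolygonData X L) :
    PolygonData X L where
  C := A.C ⊕ B.C
  disc := {α | Sum.elim (· ∈ A.disc) (· ∈ B.disc) α}
  G := (A.G ⊕g B.G) ⊔ SimpleGraph.edge (Sum.inl A.inputs[i].1) (Sum.inr B.out.1)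
  node := fun
    | .inl α, .inl α' => A.node α α'
    | .inr β, .inr β' => B.node β β'
    | .inl _, .inr _ => bpt A.inputs[i].2
    | .inr _, .inl _ => bpt B.out.2
  out := (Sum.inl A.out.1, A.out.2)
  inputs := (A.inputs.take i).map (Prod.map Sum.inl id) ++ B.inputs.map (Prod.map Sum.inr id) ++
    (A.inputs.drop (i + 1)).map (Prod.map Sum.inl id)
  map := Sum.elim A.map B.map
  liftIn := Sum.elim A.liftIn B.liftIn
  liftOut := Sum.elim A.liftOut B.liftOut

/-- Composition of the lift of a polygon with a map `j : L → L'`. -/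
def push {L' : Type w} (j : L → L') (D : PolygonData X L) : PolygonData X L' where
  C := D.C
  disc := D.disc
  G := D.G
  node := D.node
  out := D.out
  inputs := D.inputs
  map := D.map
  liftIn := fun α z => j (D.liftIn α z)
  liftOut := fun α z => j (D.liftOut α z)

end PolygonData

theorem bpt_injective : Function.Injective bpt := by
  intro z w h
  exact Subtype.ext (OnePoint.coe_injective h)

namespace PolygonData

variable {X : Type u} {L : Type v}

theorem forall₂_trans {α β γ : Type*} {R : α → β → Prop} {S : β → γ → Prop} {T : α → γ → Prop}
    (hT : ∀ a b c, R a b → S b c → T a c) {l₁ : List α} {l₂ : List β} {l₃ : List γ}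
    (h₁ : List.Forall₂ R l₁ l₂) (h₂ : List.Forall₂ S l₂ l₃) : List.Forall₂ T l₁ l₃ := by
  induction h₁ generalizing l₃ with
  | nil => cases h₂; exact .nil
  | cons h _ ih =>
    cases h₂ with
    | cons h' t => exact .cons (hT _ _ _ h h') (ih t)

/-- The identity isomorphism. -/
def Iso.refl (D : PolygonData X L) : D.Iso D where
  f := Equiv.refl _
  φ := fun _ => Equiv.refl _
  moebius := fun _ => ⟨1, fun z => by simp⟩
  disc_iff := fun _ => Iff.rfl
  image_domain := fun α => by simp
  image_inner := fun α => by simp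
  adj_iff := fun _ _ => Iff.rfl
  node_eq := fun _ _ _ => rfl
  out_eq := ⟨rfl, rfl⟩
  inputs_eq := List.forall₂_same.2 fun _ _ => ⟨rfl, rfl⟩
  map_eq := fun _ _ _ => rfl
  lift_eq := fun α _ z z' h => by
    have : z' = z := bpt_injective h
    subst this; exact ⟨rfl, rfl⟩

theorem bpt_mem_closedDisc (z : Circle) : bpt z ∈ closedDisc := ⟨z, (Circle.norm_coe z).le, rfl⟩

theorem bpt_notMem_openDisc (z : Circle) : bpt z ∉ openDisc := by
  rintro ⟨w, hw, h⟩
  have h' : (z : ℂ) = w := OnePoint.coe_injective h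
  have := Circle.norm_coe z
  rw [h'] at this
  linarith

theorem exists_bpt_eq {p : OnePoint ℂ} (h : p ∈ closedDisc) (h' : p ∉ openDisc) :
    ∃ z, p = bpt z := by
  obtain ⟨z, hz, rfl⟩ := h
  have : ‖z‖ = 1 := le_antisymm hz (not_lt.1 fun hlt => h' ⟨z, hlt, rfl⟩)
  exact ⟨⟨z, by simpa [Submonoid.unitSphere] using this⟩, rfl⟩

theorem Iso.exists_bpt {D D' : PolygonData X L} (g : D.Iso D') {α : D.C} (hα : α ∈ D.disc)
    (z : Circle) : ∃ w, bpt w = g.φ α (bpt z) := by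
  have h₁ : g.φ α (bpt z) ∈ D'.domain (g.f α) := by
    rw [← g.image_domain]; exact ⟨_, fun _ => bpt_mem_closedDisc z, rfl⟩
  have h₂ : g.φ α (bpt z) ∉ D'.inner (g.f α) := by
    rw [← g.image_inner]
    rintro ⟨w, hw, h⟩
    rw [(g.φ α).injective h] at hw
    exact bpt_notMem_openDisc z (hw hα)
  have hd := (g.disc_iff α).2 hα
  obtain ⟨w, hw⟩ := exists_bpt_eq (h₁ hd) (fun h => h₂ fun _ => h)
  exact ⟨w, hw.symm⟩

/-- Composition of isomorphisms. -/
def Iso.trans {D D' D'' : PolygonData X L} (g : D.Iso D') (h : D'.Iso D'') : D.Iso D'' where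
  f := g.f.trans h.f
  φ := fun α => (g.φ α).trans (h.φ (g.f α))
  moebius := fun α => by
    obtain ⟨a, ha⟩ := g.moebius α
    obtain ⟨b, hb⟩ := h.moebius (g.f α)
    exact ⟨b * a, fun z => by simp [ha, hb, mul_smul]⟩
  disc_iff := fun α => by simp [h.disc_iff, g.disc_iff]
  image_domain := fun α => by
    rw [Equiv.coe_trans, Set.image_comp, g.image_domain, h.image_domain]; rfl
  image_inner := fun α => by
    rw [Equiv.coe_trans, Set.image_comp, g.image_inner, h.image_inner]; rfl
  adj_iff := fun α β => by simp [h.adj_iff, g.adj_iff]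
  node_eq := fun α β hαβ => by
    simp only [Equiv.trans_apply]
    rw [h.node_eq _ _ ((g.adj_iff _ _).2 hαβ), g.node_eq _ _ hαβ]
  out_eq := by
    refine ⟨by simp [h.out_eq.1, g.out_eq.1], ?_⟩
    rw [h.out_eq.2, g.out_eq.1, g.out_eq.2]; rfl
  inputs_eq := forall₂_trans (by
    rintro ⟨a, z⟩ ⟨b, z'⟩ ⟨c, z''⟩ ⟨h₁, h₂⟩ ⟨h₃, h₄⟩
    simp only at h₁ h₂ h₃ h₄
    subst h₁
    exact ⟨h₃, by simp [h₄, h₂]⟩) g.inputs_eq h.inputs_eq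
  map_eq := fun α z hz => by
    simp only [Equiv.trans_apply]
    rw [h.map_eq, g.map_eq _ _ hz]
    rw [← g.image_domain]; exact ⟨z, hz, rfl⟩
  lift_eq := fun α hα z z' hz => by
    obtain ⟨w, hw⟩ := g.exists_bpt hα z
    have h₁ := g.lift_eq α hα z w hw
    have h₂ := h.lift_eq (g.f α) ((g.disc_iff α).2 hα) w z' (by rw [hz, hw]; rfl)
    exact ⟨h₂.1.trans h₁.1, h₂.2.trans h₁.2⟩

/-- The inverse isomorphism. -/
def Iso.symm {D D' : PolygonData X L} (g : D.Iso D') : D'.Iso D where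
  f := g.f.symm
  φ := fun α => (g.φ (g.f.symm α)).symm
  moebius := fun α => by
    obtain ⟨a, ha⟩ := g.moebius (g.f.symm α)
    refine ⟨a⁻¹, fun z => ?_⟩
    rw [Equiv.symm_apply_eq, ha, smul_inv_smul]
  disc_iff := fun α => by rw [← g.disc_iff]; simp
  image_domain := fun α => by
    obtain ⟨α, rfl⟩ := g.f.surjective α
    rw [← g.image_domain, Equiv.symm_apply_apply, Equiv.symm_image_image]
  image_inner := fun α => by
    obtain ⟨α, rfl⟩ := g.f.surjective α
    rw [← g.image_inner, Equiv.symm_apply_apply, Equiv.symm_image_image]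
  adj_iff := fun α β => by rw [← g.adj_iff]; simp
  node_eq := fun α β h => by
    obtain ⟨α, rfl⟩ := g.f.surjective α
    obtain ⟨β, rfl⟩ := g.f.surjective β
    rw [g.node_eq _ _ ((g.adj_iff _ _).1 h)]; simp
  out_eq := by
    refine ⟨by simp [g.out_eq.1], ?_⟩
    rw [g.out_eq.2, g.out_eq.1]; simp
  inputs_eq := by
    have := g.inputs_eq.flip
    refine this.imp ?_
    rintro ⟨a, z⟩ ⟨b, w⟩ ⟨h₁, h₂⟩
    simp only at h₁ h₂
    subst h₁
    simp [h₂]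
  map_eq := fun α z hz => by
    obtain ⟨α, rfl⟩ := g.f.surjective α
    rw [← g.image_domain] at hz
    obtain ⟨w, hw, rfl⟩ := hz
    rw [g.map_eq _ _ hw]; simp
  lift_eq := fun α hα z z' hz => by
    obtain ⟨α, rfl⟩ := g.f.surjective α
    simp only [Equiv.symm_apply_apply] at hz ⊢
    have := g.lift_eq α ((g.disc_iff α).1 hα) z' z (by rw [hz]; simp)
    exact ⟨this.1.symm, this.2.symm⟩

theorem Iso.ext' {D D' : PolygonData X L} {g h : D.Iso D'} (h₁ : g.f = h.f) (h₂ : g.φ = h.φ) :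
    g = h := by
  cases g; cases h; congr

/-- Finiteness of the automorphism group is detected on the automorphisms that fix all components. -/
theorem finite_iso_self {D : PolygonData X L} [Finite D.C]
    (h : {g : D.Iso D | g.f = Equiv.refl _}.Finite) : Finite (D.Iso D) := by
  rw [← Set.finite_univ_iff]
  have : (Set.univ : Set (D.Iso D)) = ⋃ f : D.C ≃ D.C, {g | g.f = f} := by
    ext; simp
  rw [this]
  refine Set.finite_iUnion fun f => ?_
  by_cases hf : ∃ g₀ : D.Iso D, g₀.f = f
  · obtain ⟨g₀, rfl⟩ := hf
    refine Set.Finite.of_injOn (f := fun g : D.Iso D => g.trans g₀.symm) ?_ ?_ h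
    · intro g hg
      ext α
      have : g.f = g₀.f := hg
      simp [Iso.trans, Iso.symm, this]
    · intro g hg g' hg' e
      have h₁ : g.f = g₀.f := hg
      have h₂ : g'.f = g₀.f := hg'
      refine Iso.ext' (h₁.trans h₂.symm) ?_
      funext α
      have := congrFun (congrArg Iso.φ e) α
      simp only [Iso.trans, Iso.symm, h₁, h₂] at this
      ext z
      have := Equiv.congr_fun this z
      simpa using this
  · convert Set.finite_empty
    exact Set.eq_empty_of_forall_notMem fun g hg => hf ⟨g, hg⟩

end PolygonData

namespace PolygonData

variable {X : Type u} {L : Type v}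

section Glue

variable {A : PolygonData X L} {i : ℕ} {hi : i < A.inputs.length} {B : PolygonData X L}

theorem inputs_split (A : PolygonData X L) (i : ℕ) (hi : i < A.inputs.length) :
    A.inputs.take i ++ A.inputs[i] :: A.inputs.drop (i + 1) = A.inputs := by
  simp

@[simp] theorem glue_adj_ll (a a' : A.C) :
    (A.glue i hi B).G.Adj (.inl a) (.inl a') ↔ A.G.Adj a a' := by
  simp [glue, SimpleGraph.edge_adj]

@[simp] theorem glue_adj_rr (b b' : B.C) :
    (A.glue i hi B).G.Adj (.inr b) (.inr b') ↔ B.G.Adj b b' := by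
  simp [glue, SimpleGraph.edge_adj]

@[simp] theorem glue_adj_lr (a : A.C) (b : B.C) :
    (A.glue i hi B).G.Adj (.inl a) (.inr b) ↔ a = A.inputs[i].1 ∧ b = B.out.1 := by
  simp [glue, SimpleGraph.edge_adj]

@[simp] theorem glue_adj_rl (a : A.C) (b : B.C) :
    (A.glue i hi B).G.Adj (.inr b) (.inl a) ↔ a = A.inputs[i].1 ∧ b = B.out.1 := by
  rw [SimpleGraph.adj_comm, glue_adj_lr]

@[simp] theorem glue_mem_disc_l (a : A.C) : Sum.inl a ∈ (A.glue i hi B).disc ↔ a ∈ A.disc := Iff.rfl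
@[simp] theorem glue_mem_disc_r (b : B.C) : Sum.inr b ∈ (A.glue i hi B).disc ↔ b ∈ B.disc := Iff.rfl
@[simp] theorem glue_domain_l (a : A.C) : (A.glue i hi B).domain (.inl a) = A.domain a := rfl
@[simp] theorem glue_domain_r (b : B.C) : (A.glue i hi B).domain (.inr b) = B.domain b := rfl
@[simp] theorem glue_inner_l (a : A.C) : (A.glue i hi B).inner (.inl a) = A.inner a := rfl
@[simp] theorem glue_inner_r (b : B.C) : (A.glue i hi B).inner (.inr b) = B.inner b := rfl

theorem mem_inputs_iff (p : A.C × Circle) :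
    p ∈ A.inputs ↔ p ∈ A.inputs.take i ∨ p = A.inputs[i] ∨ p ∈ A.inputs.drop (i + 1) := by
  conv_lhs => rw [← inputs_split A i hi]
  rw [List.mem_append, List.mem_cons]

theorem glue_mem_inputs_l (a : A.C) (z : Circle) : (Sum.inl a, z) ∈ (A.glue i hi B).inputs ↔
    (a, z) ∈ A.inputs.take i ∨ (a, z) ∈ A.inputs.drop (i + 1) := by
  simp [-List.map_take, -List.map_drop]

theorem glue_mem_inputs_r (b : B.C) (z : Circle) : (Sum.inr b, z) ∈ (A.glue i hi B).inputs ↔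
    (b, z) ∈ B.inputs := by
  simp [-List.map_take, -List.map_drop]

theorem glue_mem_marked_l (a : A.C) (z : Circle) :
    (Sum.inl a, z) ∈ (A.glue i hi B).out :: (A.glue i hi B).inputs ↔
    (a, z) = A.out ∨ (a, z) ∈ A.inputs.take i ∨ (a, z) ∈ A.inputs.drop (i + 1) := by
  rw [List.mem_cons, glue_mem_inputs_l]
  refine or_congr ?_ Iff.rfl
  simp [Prod.ext_iff]

theorem glue_mem_marked_r (b : B.C) (z : Circle) :
    (Sum.inr b, z) ∈ (A.glue i hi B).out :: (A.glue i hi B).inputs ↔ (b, z) ∈ B.inputs := by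
  rw [List.mem_cons, glue_mem_inputs_r]
  simp

theorem mem_special {D : PolygonData X L} {α : D.C} {z : OnePoint ℂ} : z ∈ D.special α ↔
    (∃ β, D.G.Adj α β ∧ z = D.node α β) ∨ ∃ w, (α, w) ∈ D.out :: D.inputs ∧ z = bpt w := by
  refine or_congr Iff.rfl ⟨?_, ?_⟩
  · rintro ⟨⟨a, w⟩, h, rfl, rfl⟩; exact ⟨w, h, rfl⟩
  · rintro ⟨w, h, rfl⟩; exact ⟨(α, w), h, rfl, rfl⟩

@[simp] theorem glue_special_l (a : A.C) : (A.glue i hi B).special (.inl a) = A.special a := by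
  ext z
  rw [mem_special, mem_special]
  constructor
  · rintro (⟨β | β, h, rfl⟩ | ⟨w, h, rfl⟩)
    · exact .inl ⟨β, (glue_adj_ll _ _).1 h, rfl⟩
    · have := (glue_adj_lr _ _).1 h
      refine .inr ⟨A.inputs[i].2, ?_, rfl⟩
      rw [this.1]; simp
    · refine .inr ⟨w, ?_, rfl⟩
      rw [glue_mem_marked_l] at h
      rw [List.mem_cons, mem_inputs_iff (i := i) (hi := hi)]
      tauto
  · rintro (⟨β, h, rfl⟩ | ⟨w, h, rfl⟩)
    · exact .inl ⟨.inl β, (glue_adj_ll _ _).2 h, rfl⟩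
    · rw [List.mem_cons, mem_inputs_iff (i := i) (hi := hi)] at h
      by_cases e : (a, w) = A.inputs[i]
      · refine .inl ⟨.inr B.out.1, (glue_adj_lr _ _).2 ⟨by rw [← e], rfl⟩, ?_⟩
        simp [← e]
      · refine .inr ⟨w, ?_, rfl⟩
        rw [glue_mem_marked_l]
        tauto

@[simp] theorem glue_special_r (b : B.C) : (A.glue i hi B).special (.inr b) = B.special b := by
  ext z
  rw [mem_special, mem_special]
  constructor
  · rintro (⟨β | β, h, rfl⟩ | ⟨w, h, rfl⟩)
    · have := (glue_adj_rl _ _).1 h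
      refine .inr ⟨B.out.2, ?_, rfl⟩
      rw [this.2]; simp
    · exact .inl ⟨β, (glue_adj_rr _ _).1 h, rfl⟩
    · refine .inr ⟨w, ?_, rfl⟩
      rw [glue_mem_marked_r] at h
      exact List.mem_cons_of_mem _ h
  · rintro (⟨β, h, rfl⟩ | ⟨w, h, rfl⟩)
    · exact .inl ⟨.inr β, (glue_adj_rr _ _).2 h, rfl⟩
    · rcases List.mem_cons.1 h with e | h
      · refine .inl ⟨.inl A.inputs[i].1, (glue_adj_rl _ _).2 ⟨rfl, by rw [← e]⟩, ?_⟩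
        simp [← e]
      · exact .inr ⟨w, (glue_mem_marked_r _ _).2 h, rfl⟩

/-- The inclusion of the boundary points of the first piece. -/
abbrev il (A B : PolygonData X L) : A.C × Circle → (A.C ⊕ B.C) × Circle := Prod.map Sum.inl id
/-- The inclusion of the boundary points of the second piece. -/
abbrev ir (A B : PolygonData X L) : B.C × Circle → (A.C ⊕ B.C) × Circle := Prod.map Sum.inr id

theorem glue_next_l {p q : A.C × Circle} (h : A.Next p q) :
    (A.glue i hi B).Next (il A B p) (il A B q) := by
  obtain ⟨h₁, h₂, θ, hθ, h₃, h₄⟩ := h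
  refine ⟨by simp [h₁], ?_, θ, hθ, h₃, ?_⟩
  · exact (glue_special_l q.1).symm ▸ h₂
  · intro θ' hθ'
    exact (glue_special_l (hi := hi) (B := B) p.1).symm ▸ h₄ θ' hθ'

theorem glue_next_r {p q : B.C × Circle} (h : B.Next p q) :
    (A.glue i hi B).Next (ir A B p) (ir A B q) := by
  obtain ⟨h₁, h₂, θ, hθ, h₃, h₄⟩ := h
  refine ⟨by simp [h₁], ?_, θ, hθ, h₃, ?_⟩
  · exact (glue_special_r q.1).symm ▸ h₂
  · intro θ' hθ'
    exact (glue_special_r (hi := hi) (A := A) p.1).symm ▸ h₄ θ' hθ'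

theorem glue_glued_lr : (A.glue i hi B).Glued (il A B A.inputs[i]) (ir A B B.out) :=
  ⟨(glue_adj_lr _ _).2 ⟨rfl, rfl⟩, rfl, rfl⟩

theorem glue_glued_rl : (A.glue i hi B).Glued (ir A B B.out) (il A B A.inputs[i]) :=
  ⟨(glue_adj_rl _ _).2 ⟨rfl, rfl⟩, rfl, rfl⟩

theorem glue_glued_l {p q : A.C × Circle} (h : A.Glued p q) :
    (A.glue i hi B).Glued (il A B p) (il A B q) :=
  ⟨(glue_adj_ll _ _).2 h.1, h.2.1, h.2.2⟩

theorem glue_glued_r {p q : B.C × Circle} (h : B.Glued p q) :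
    (A.glue i hi B).Glued (ir A B p) (ir A B q) :=
  ⟨(glue_adj_rr _ _).2 h.1, h.2.1, h.2.2⟩

theorem glue_step_l {p q : A.C × Circle} (hp : p ≠ A.inputs[i]) (h : A.Step p q) :
    (A.glue i hi B).Step (il A B p) (il A B q) := by
  rcases h with ⟨h, h'⟩ | ⟨p', h, h'⟩
  · refine .inl ⟨?_, glue_next_l h'⟩
    rw [List.mem_cons, mem_inputs_iff (i := i) (hi := hi)] at h
    refine (glue_mem_marked_l p.1 p.2).2 ?_
    tauto
  · exact .inr ⟨_, glue_glued_l h, glue_next_l h'⟩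

theorem glue_step_r {p q : B.C × Circle} (hp : p ≠ B.out) (h : B.Step p q) :
    (A.glue i hi B).Step (ir A B p) (ir A B q) := by
  rcases h with ⟨h, h'⟩ | ⟨p', h, h'⟩
  · refine .inl ⟨?_, glue_next_r h'⟩
    refine (glue_mem_marked_r p.1 p.2).2 ?_
    simpa [hp] using h
  · exact .inr ⟨_, glue_glued_r h, glue_next_r h'⟩

end Glue

end PolygonData

namespace PolygonData

variable {X : Type u} {L : Type v}

/-- Restriction to the first piece of an automorphism of a glued polygon that fixes all components. -/
def isoLeft {A : PolygonData X L} {i : ℕ} {hi : i < A.inputs.length} {B : PolygonData X L}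
    (g : (A.glue i hi B).Iso (A.glue i hi B)) (hg : g.f = Equiv.refl _) : A.Iso A where
  f := Equiv.refl _
  φ := fun a => g.φ (.inl a)
  moebius := fun a => g.moebius _
  disc_iff := fun _ => Iff.rfl
  image_domain := fun a => by simpa [hg] using g.image_domain (.inl a)
  image_inner := fun a => by simpa [hg] using g.image_inner (.inl a)
  adj_iff := fun _ _ => Iff.rfl
  node_eq := fun a a' h => by
    simpa [hg] using g.node_eq (.inl a) (.inl a') ((glue_adj_ll _ _).2 h)
  out_eq := ⟨rfl, g.out_eq.2⟩
  inputs_eq := by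
    refine List.forall₂_same.2 fun p hp => ⟨rfl, ?_⟩
    rw [mem_inputs_iff (i := i) (hi := hi)] at hp
    have key := g.inputs_eq
    rw [List.forall₂_same] at key
    rcases hp with h | rfl | h
    · exact (key (il A B p) ((glue_mem_inputs_l _ _).2 (.inl h))).2
    · have := g.node_eq (.inl A.inputs[i].1) (.inr B.out.1) ((glue_adj_lr _ _).2 ⟨rfl, rfl⟩)
      simpa [hg] using this
    · exact (key (il A B p) ((glue_mem_inputs_l _ _).2 (.inr h))).2
  map_eq := fun a z hz => by simpa [hg] using g.map_eq (.inl a) z hz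
  lift_eq := fun a ha z z' h => by simpa [hg] using g.lift_eq (.inl a) ha z z' h

/-- Restriction to the second piece of an automorphism of a glued polygon that fixes all
components. -/
def isoRight {A : PolygonData X L} {i : ℕ} {hi : i < A.inputs.length} {B : PolygonData X L}
    (g : (A.glue i hi B).Iso (A.glue i hi B)) (hg : g.f = Equiv.refl _) : B.Iso B where
  f := Equiv.refl _
  φ := fun b => g.φ (.inr b)
  moebius := fun a => g.moebius _
  disc_iff := fun _ => Iff.rfl
  image_domain := fun a => by simpa [hg] using g.image_domain (.inr a)
  image_inner := fun a => by simpa [hg] using g.image_inner (.inr a)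
  adj_iff := fun _ _ => Iff.rfl
  node_eq := fun a a' h => by
    simpa [hg] using g.node_eq (.inr a) (.inr a') ((glue_adj_rr _ _).2 h)
  out_eq := by
    refine ⟨rfl, ?_⟩
    have := g.node_eq (.inr B.out.1) (.inl A.inputs[i].1) ((glue_adj_rl _ _).2 ⟨rfl, rfl⟩)
    simpa [hg] using this
  inputs_eq := by
    refine List.forall₂_same.2 fun p hp => ⟨rfl, ?_⟩
    have key := g.inputs_eq
    rw [List.forall₂_same] at key
    exact (key (ir A B p) ((glue_mem_inputs_r _ _).2 hp)).2
  map_eq := fun a z hz => by simpa [hg] using g.map_eq (.inr a) z hz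
  lift_eq := fun a ha z z' h => by simpa [hg] using g.lift_eq (.inr a) ha z z' h

theorem glue_finite_iso {A : PolygonData X L} {i : ℕ} {hi : i < A.inputs.length}
    {B : PolygonData X L} [Finite A.C] [Finite B.C] [Finite (A.Iso A)] [Finite (B.Iso B)] :
    Finite ((A.glue i hi B).Iso (A.glue i hi B)) := by
  have : Finite (A.glue i hi B).C := inferInstanceAs (Finite (A.C ⊕ B.C))
  refine finite_iso_self ?_
  rw [← Set.finite_coe_iff]
  refine Finite.of_injective (β := A.Iso A × B.Iso B)
    (fun g => (isoLeft g.1 g.2, isoRight g.1 g.2)) ?_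
  rintro ⟨g, hg⟩ ⟨g', hg'⟩ h
  simp only [Prod.mk.injEq] at h
  refine Subtype.ext (Iso.ext' (hg.trans hg'.symm) ?_)
  funext a
  rcases a with a | b
  · exact congrFun (congrArg Iso.φ h.1) a
  · exact congrFun (congrArg Iso.φ h.2) b

theorem tree_glue {V W : Type} [Finite V] [Finite W] {G : SimpleGraph V} {H : SimpleGraph W}
    (hG : G.IsTree) (hH : H.IsTree) (v : V) (w : W) :
    ((G ⊕g H) ⊔ SimpleGraph.edge (Sum.inl v) (Sum.inr w)).IsTree := by
  rw [SimpleGraph.isTree_iff_connected_and_card] at hG hH ⊢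
  refine ⟨hG.1.sum_sup_edge hH.1, ?_⟩
  have e₁ : Nat.card (G ⊕g H).edgeSet = Nat.card G.edgeSet + Nat.card H.edgeSet := by
    rw [Nat.card_congr SimpleGraph.edgeSetSumEquiv, Nat.card_sum]
  have e₂ : ((G ⊕g H) ⊔ SimpleGraph.edge (Sum.inl v) (Sum.inr w)).edgeSet =
      insert s(Sum.inl v, Sum.inr w) (G ⊕g H).edgeSet := by
    ext e
    induction e with
    | _ x y => rcases x with x | x <;> rcases y with y | y <;> simp
  rw [e₂, Nat.card_coe_set_eq, Set.ncard_insert_of_notMem (by simp), ← Nat.card_coe_set_eq, e₁,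
    Nat.card_sum]
  omega

theorem splice_perm {α : Type*} (a b c : α) (k m l : List α) :
    (a :: (k ++ b :: (m ++ c :: l))).Perm ((a :: (k ++ b :: l)) ++ (c :: m)) := by
  classical
  rw [List.perm_iff_count]
  intro x
  simp only [List.count_cons, List.count_append]
  ring

theorem chain_map_init {α β : Type*} {R : α → α → Prop} {S : β → β → Prop} (f : α → β) {a : α}
    {l : List α} (h : List.IsChain R (l ++ [a])) (hf : ∀ x ∈ l, ∀ y, R x y → S (f x) (f y)) :
    List.IsChain S (l.map f ++ [f a]) := by
  induction l with
  | nil => simp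
  | cons b l ih =>
    cases l with
    | nil =>
      simp only [List.cons_append, List.nil_append, List.isChain_cons_cons, List.map_cons,
        List.map_nil] at h ⊢
      exact ⟨hf _ (by simp) _ h.1, by simp⟩
    | cons c l =>
      simp only [List.cons_append, List.isChain_cons_cons, List.map_cons] at h ih ⊢
      exact ⟨hf _ (by simp) _ h.1, ih h.2 fun x hx => hf x (by simp at hx ⊢; tauto)⟩

section Glue

variable {A : PolygonData X L} {i : ℕ} {hi : i < A.inputs.length} {B : PolygonData X L}

theorem glue_order
    (hnA : ∀ q, A.Step A.inputs[i] q → A.Next A.inputs[i] q)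
    (hnB : ∀ q, B.Step B.out q → B.Next B.out q)
    (hA : ∃ l : List (A.C × Circle), (A.out :: l).Nodup ∧
      (∀ p, p ∈ A.out :: l ↔ p.1 ∈ A.disc ∧ bpt p.2 ∈ A.special p.1) ∧
      List.IsChain A.Step (A.out :: l ++ [A.out]) ∧ A.inputs.Sublist l)
    (hB : ∃ l : List (B.C × Circle), (B.out :: l).Nodup ∧
      (∀ p, p ∈ B.out :: l ↔ p.1 ∈ B.disc ∧ bpt p.2 ∈ B.special p.1) ∧
      List.IsChain B.Step (B.out :: l ++ [B.out]) ∧ B.inputs.Sublist l) :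
    ∃ l : List ((A.glue i hi B).C × Circle), ((A.glue i hi B).out :: l).Nodup ∧
      (∀ p, p ∈ (A.glue i hi B).out :: l ↔
        p.1 ∈ (A.glue i hi B).disc ∧ bpt p.2 ∈ (A.glue i hi B).special p.1) ∧
      List.IsChain (A.glue i hi B).Step ((A.glue i hi B).out :: l ++ [(A.glue i hi B).out]) ∧
      (A.glue i hi B).inputs.Sublist l := by
  obtain ⟨l, hnd, hmem, hch, hsub⟩ := hA
  obtain ⟨m, mnd, mmem, mch, msub⟩ := hB
  have hsub' := hsub
  rw [← inputs_split A i hi, List.append_sublist_iff] at hsub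
  obtain ⟨l₁, l₂', rfl, hs₁, hs₂⟩ := hsub
  rw [List.cons_sublist_iff] at hs₂
  obtain ⟨l₂, l₃, rfl, hz, hs₃⟩ := hs₂
  obtain ⟨l₄, l₅, rfl⟩ := List.append_of_mem hz
  obtain ⟨zi, hzi⟩ : ∃ z, A.inputs[i] = z := ⟨_, rfl⟩
  rw [hzi] at hnd hmem hch hz
  -- the traversal of `A` is `out, k₁, zi, k₂`
  obtain ⟨k₁, hk₁⟩ : ∃ k, k = l₁ ++ l₄ := ⟨_, rfl⟩
  obtain ⟨k₂, hk₂⟩ : ∃ k, k = l₅ ++ l₃ := ⟨_, rfl⟩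
  have hl : l₁ ++ (l₄ ++ zi :: l₅ ++ l₃) = k₁ ++ zi :: k₂ := by simp [hk₁, hk₂]
  rw [hl] at hnd hmem hch
  have hs₁' : (A.inputs.take i).Sublist k₁ := hs₁.trans (by simp [hk₁])
  have hs₃' : (A.inputs.drop (i + 1)).Sublist k₂ := hs₃.trans (by simp [hk₂])
  have hlI : Function.Injective (il A B) := Sum.inl_injective.prodMap Function.injective_id
  have hrI : Function.Injective (ir A B) := Sum.inr_injective.prodMap Function.injective_id
  have hne : ∀ x y, il A B x ≠ ir A B y := by
    intro x y h; simpa using congrArg Prod.fst h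
  have hne' : ∀ x y, ir A B x ≠ il A B y := fun x y h => hne _ _ h.symm
  refine ⟨k₁.map (il A B) ++ il A B zi :: (m.map (ir A B) ++ ir A B B.out :: k₂.map (il A B)),
    ?_, ?_, ?_, ?_⟩
  · have e := splice_perm (il A B A.out) (il A B zi) (ir A B B.out) (k₁.map (il A B))
      (m.map (ir A B)) (k₂.map (il A B))
    have e' : (il A B A.out :: (k₁.map (il A B) ++ il A B zi :: k₂.map (il A B))) ++
        (ir A B B.out :: m.map (ir A B)) =
        (A.out :: (k₁ ++ zi :: k₂)).map (il A B) ++ (B.out :: m).map (ir A B) := by simp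
    rw [e'] at e
    refine (List.Perm.nodup_iff e).2 ?_
    rw [List.nodup_append]
    refine ⟨hnd.map hlI, mnd.map hrI, ?_⟩
    intro a ha b hb
    obtain ⟨x, -, rfl⟩ := List.mem_map.1 ha
    obtain ⟨y, -, rfl⟩ := List.mem_map.1 hb
    exact hne x y
  · rintro ⟨a | b, z⟩
    · have := hmem (a, z)
      simp only [glue_special_l]
      refine Iff.trans ?_ this
      simp [Prod.ext_iff]
    · have := mmem (b, z)
      simp only [glue_special_r]
      refine Iff.trans ?_ this
      simp [Prod.ext_iff, or_comm]
  · have hch' : List.IsChain A.Step ((A.out :: k₁) ++ zi :: (k₂ ++ [A.out])) := by simpa using hch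
    rw [List.isChain_split] at hch'
    have hz₁ : zi ∉ A.out :: k₁ := by
      intro h
      have : (A.out :: k₁ ++ zi :: k₂).Nodup := hnd
      exact List.disjoint_of_nodup_append this h (by simp)
    have hz₂ : zi ∉ k₂ := by
      have : (A.out :: k₁ ++ zi :: k₂).Nodup := hnd
      exact (List.nodup_cons.1 (List.nodup_append.1 this).2.1).1
    have c₁ := chain_map_init (S := (A.glue i hi B).Step) (il A B) hch'.1 fun x hx y hxy =>
      glue_step_l (by rw [hzi]; rintro rfl; exact hz₁ hx) hxy
    have h₂ := (List.isChain_cons.1 hch'.2)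
    have c₂ := chain_map_init (S := (A.glue i hi B).Step) (il A B) h₂.2 fun x hx y hxy =>
      glue_step_l (by rw [hzi]; rintro rfl; exact hz₂ hx) hxy
    have h₃ := (List.isChain_cons.1 mch)
    have c₃ := chain_map_init (S := (A.glue i hi B).Step) (ir A B) h₃.2 fun x hx y hxy =>
      glue_step_r (by rintro rfl; exact (List.nodup_cons.1 mnd).1 hx) hxy
    have e : (A.glue i hi B).out :: (k₁.map (il A B) ++
        il A B zi :: (m.map (ir A B) ++ ir A B B.out :: k₂.map (il A B))) ++
          [(A.glue i hi B).out] =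
        (A.out :: k₁).map (il A B) ++ il A B zi ::
          (m.map (ir A B) ++ ir A B B.out :: (k₂.map (il A B) ++ [il A B A.out])) := by
      simp
      rfl
    rw [e, List.isChain_split]
    refine ⟨c₁, ?_⟩
    have d₂ : List.IsChain (A.glue i hi B).Step
        (ir A B B.out :: (k₂.map (il A B) ++ [il A B A.out])) := by
      refine List.isChain_cons.2 ⟨fun y hy => ?_, c₂⟩
      have hy' : y ∈ ((k₂ ++ [A.out]).map (il A B)).head? := by simpa using hy
      rw [List.head?_map, Option.mem_map] at hy'
      obtain ⟨q, hq, rfl⟩ := hy'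
      refine .inr ⟨_, glue_glued_rl, glue_next_l (hnA q ?_)⟩
      rw [hzi]; exact h₂.1 q hq
    have d₁ : List.IsChain (A.glue i hi B).Step
        (il A B zi :: (m.map (ir A B) ++ [ir A B B.out])) := by
      refine List.isChain_cons.2 ⟨fun y hy => ?_, c₃⟩
      have hy' : y ∈ ((m ++ [B.out]).map (ir A B)).head? := by simpa using hy
      rw [List.head?_map, Option.mem_map] at hy'
      obtain ⟨q, hq, rfl⟩ := hy'
      refine .inr ⟨_, ?_, glue_next_r (hnB q (h₃.1 q hq))⟩
      rw [← hzi]; exact glue_glued_lr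
    rw [← List.cons_append, List.isChain_split]
    exact ⟨d₁, d₂⟩
  · have e : (A.glue i hi B).inputs = (A.inputs.take i).map (il A B) ++ (B.inputs.map (ir A B) ++
        (A.inputs.drop (i + 1)).map (il A B)) := List.append_assoc _ _ _
    rw [e]
    refine (hs₁'.map _).append ?_
    refine List.Sublist.cons _ ?_
    refine (msub.map _).append ?_
    exact List.Sublist.cons _ (hs₃'.map _)

theorem IsStable.step_marked [TopologicalSpace X] [TopologicalSpace L] {d : ℕ}
    [ChartedSpace (EuclideanSpace ℝ (Fin d)) X] [IsManifold (𝓡 d) ∞ X]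
    {J : AlmostComplexStructure (d := d) X} {ι : L → X} {D : PolygonData X L}
    (hD : D.IsStable J ι) {p q : D.C × Circle} (hp : p ∈ D.out :: D.inputs) (h : D.Step p q) :
    D.Next p q := by
  rcases h with ⟨-, h⟩ | ⟨p', h, -⟩
  · exact h
  · exact absurd h.2.1 (hD.marked_ne_node p hp _ h.1)

theorem IsStable.glue [TopologicalSpace X] [TopologicalSpace L] {d : ℕ}
    [ChartedSpace (EuclideanSpace ℝ (Fin d)) X] [IsManifold (𝓡 d) ∞ X]
    {J : AlmostComplexStructure (d := d) X} {ι : L → X}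
    (hA : A.IsStable J ι) (hB : B.IsStable J ι)
    (h₁ : A.liftIn A.inputs[i].1 A.inputs[i].2 = B.liftOut B.out.1 B.out.2)
    (h₂ : A.liftOut A.inputs[i].1 A.inputs[i].2 = B.liftIn B.out.1 B.out.2) :
    (A.glue i hi B).IsStable J ι := by
  have hzA : A.inputs[i] ∈ A.out :: A.inputs := List.mem_cons_of_mem _ (List.getElem_mem hi)
  have hoB : B.out ∈ B.out :: B.inputs := List.mem_cons_self
  have hzd : A.inputs[i].1 ∈ A.disc := hA.inputs_disc _ (List.getElem_mem hi)
  have := hA.finite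
  have := hB.finite
  have := hA.stable
  have := hB.stable
  exact
  { finite := inferInstanceAs (Finite (A.C ⊕ B.C))
    tree := tree_glue hA.tree hB.tree _ _
    out_disc := hA.out_disc
    inputs_disc := by
      rintro ⟨a | b, z⟩ h
      · rw [glue_mem_inputs_l] at h
        refine hA.inputs_disc (a, z) ((mem_inputs_iff (i := i) (hi := hi) _).2 ?_)
        tauto
      · exact hB.inputs_disc (b, z) ((glue_mem_inputs_r _ _).1 h)
    node_bdry := by
      rintro (a | b) (a' | b') h ha hb
      · exact hA.node_bdry _ _ ((glue_adj_ll _ _).1 h) ha hb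
      · exact ⟨_, rfl⟩
      · exact ⟨_, rfl⟩
      · exact hB.node_bdry _ _ ((glue_adj_rr _ _).1 h) ha hb
    node_inner := by
      rintro (a | b) (a' | b') h hab
      · exact hA.node_inner _ _ ((glue_adj_ll _ _).1 h) hab
      · obtain ⟨rfl, rfl⟩ := (glue_adj_lr _ _).1 h
        exact absurd ⟨hzd, hB.out_disc⟩ hab
      · obtain ⟨rfl, rfl⟩ := (glue_adj_rl _ _).1 h
        exact absurd ⟨hB.out_disc, hzd⟩ hab
      · exact hB.node_inner _ _ ((glue_adj_rr _ _).1 h) hab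
    node_inj := by
      rintro (a | b) (a' | b') (a'' | b'') h h' e
      · rw [hA.node_inj _ _ _ ((glue_adj_ll _ _).1 h) ((glue_adj_ll _ _).1 h') e]
      · obtain ⟨rfl, rfl⟩ := (glue_adj_lr _ _).1 h'
        exact absurd e.symm (hA.marked_ne_node _ hzA _ ((glue_adj_ll _ _).1 h))
      · obtain ⟨rfl, rfl⟩ := (glue_adj_lr _ _).1 h
        exact absurd e (hA.marked_ne_node _ hzA _ ((glue_adj_ll _ _).1 h'))
      · rw [((glue_adj_lr _ _).1 h).2, ((glue_adj_lr _ _).1 h').2]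
      · rw [((glue_adj_rl _ _).1 h).1, ((glue_adj_rl _ _).1 h').1]
      · obtain ⟨rfl, rfl⟩ := (glue_adj_rl _ _).1 h
        exact absurd e (hB.marked_ne_node _ hoB _ ((glue_adj_rr _ _).1 h'))
      · obtain ⟨rfl, rfl⟩ := (glue_adj_rl _ _).1 h'
        exact absurd e.symm (hB.marked_ne_node _ hoB _ ((glue_adj_rr _ _).1 h))
      · rw [hB.node_inj _ _ _ ((glue_adj_rr _ _).1 h) ((glue_adj_rr _ _).1 h') e]
    marked_nodup := by
      obtain ⟨l, hnd, -, -, hs⟩ := glue_order (i := i) (hi := hi)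
        (fun q => hA.step_marked hzA) (fun q => hB.step_marked hoB) hA.order hB.order
      exact hnd.sublist (List.Sublist.cons_cons _ hs)
    marked_ne_node := by
      rintro ⟨a | b, z⟩ hp (a' | b') h e
      · rw [glue_mem_marked_l] at hp
        refine hA.marked_ne_node (a, z) ?_ a' ((glue_adj_ll _ _).1 h) e
        rw [List.mem_cons, mem_inputs_iff (i := i) (hi := hi)]
        tauto
      · obtain ⟨rfl, rfl⟩ := (glue_adj_lr _ _).1 h
        have hz : z = A.inputs[i].2 := bpt_injective e
        subst hz
        rw [glue_mem_marked_l] at hp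
        have hnd := hA.marked_nodup
        rw [← inputs_split A i hi] at hnd
        change A.inputs[i] = _ ∨ A.inputs[i] ∈ _ ∨ A.inputs[i] ∈ _ at hp
        generalize A.inputs[i] = zi at hp hnd
        simp only [List.nodup_cons, List.nodup_append, List.mem_append, List.mem_cons] at hnd
        rcases hp with h | h | h
        · exact hnd.1 (.inr (.inl h.symm))
        · exact hnd.2.2.2 _ h _ (.inl rfl) rfl
        · exact hnd.2.2.1.1 h
      · obtain ⟨rfl, rfl⟩ := (glue_adj_rl _ _).1 h
        have hz : z = B.out.2 := bpt_injective e
        subst hz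
        rw [glue_mem_marked_r] at hp
        exact (List.nodup_cons.1 hB.marked_nodup).1 hp
      · rw [glue_mem_marked_r] at hp
        exact hB.marked_ne_node (b, z) (List.mem_cons_of_mem _ hp) b' ((glue_adj_rr _ _).1 h) e
    bdry_special := by
      rintro (a | b) h
      · rw [glue_special_l]; exact hA.bdry_special a h
      · rw [glue_special_r]; exact hB.bdry_special b h
    order := glue_order (fun q => hA.step_marked hzA) (fun q => hB.step_marked hoB)
      hA.order hB.order
    continuous := by
      rintro (a | b)
      · exact hA.continuous a
      · exact hB.continuous b
    holomorphic := by
      rintro (a | b)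
      · exact hA.holomorphic a
      · exact hB.holomorphic b
    holomorphic_infty := by
      rintro (a | b)
      · exact hA.holomorphic_infty a
      · exact hB.holomorphic_infty b
    map_node := by
      have key : A.map A.inputs[i].1 (bpt A.inputs[i].2) = B.map B.out.1 (bpt B.out.2) := by
        rw [← (hA.lift_map _ hzd _).1, ← (hB.lift_map _ hB.out_disc _).2, h₁]
      rintro (a | b) (a' | b') h
      · exact hA.map_node _ _ ((glue_adj_ll _ _).1 h)
      · obtain ⟨rfl, rfl⟩ := (glue_adj_lr _ _).1 h
        exact key
      · obtain ⟨rfl, rfl⟩ := (glue_adj_rl _ _).1 h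
        exact key.symm
      · exact hB.map_node _ _ ((glue_adj_rr _ _).1 h)
    lift_map := by
      rintro (a | b)
      · exact hA.lift_map a
      · exact hB.lift_map b
    lift_eq := by
      rintro (a | b) h z hz
      · rw [glue_special_l] at hz; exact hA.lift_eq a h z hz
      · rw [glue_special_r] at hz; exact hB.lift_eq b h z hz
    lift_tendsto := by
      rintro (a | b)
      · exact hA.lift_tendsto a
      · exact hB.lift_tendsto b
    lift_node := by
      rintro ⟨a | b, z⟩ ⟨a' | b', z'⟩ ⟨h, e, e'⟩ hp hq
      · exact hA.lift_node (a, z) (a', z') ⟨(glue_adj_ll _ _).1 h, e, e'⟩ hp hq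
      · obtain ⟨rfl, rfl⟩ := (glue_adj_lr _ _).1 h
        obtain rfl : z = _ := bpt_injective e
        obtain rfl : z' = _ := bpt_injective e'
        exact h₁
      · obtain ⟨rfl, rfl⟩ := (glue_adj_rl _ _).1 h
        obtain rfl : z = _ := bpt_injective e
        obtain rfl : z' = _ := bpt_injective e'
        exact h₂.symm
      · exact hB.lift_node (b, z) (b', z') ⟨(glue_adj_rr _ _).1 h, e, e'⟩ hp hq
    stable := glue_finite_iso }

end Glue

end PolygonData

theorem splice_eq {α : Type*} {a b : List α} {z : α} {i : ℕ} (h : a.length = i) (ys : List α) :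
    (a ++ z :: b).take i ++ ys ++ (a ++ z :: b).drop (i + 1) = a ++ ys ++ b := by
  subst h; simp

theorem exists_split {α : Type*} {xs : List α} {i : ℕ} (hi : i < xs.length) :
    ∃ a z b, xs = a ++ z :: b ∧ a.length = i :=
  ⟨xs.take i, xs[i], xs.drop (i + 1), by simp, by simp; omega⟩

theorem splice_assoc {α : Type*} (xs ys zs : List α) (i j : ℕ) (hi : i < xs.length)
    (hj : j < ys.length) :
    (xs.take i ++ ys ++ xs.drop (i + 1)).take (i + j) ++ zs ++
      (xs.take i ++ ys ++ xs.drop (i + 1)).drop (i + j + 1) =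
    xs.take i ++ (ys.take j ++ zs ++ ys.drop (j + 1)) ++ xs.drop (i + 1) := by
  obtain ⟨a, x, b, rfl, ha⟩ := exists_split hi
  obtain ⟨c, y, d, rfl, hc⟩ := exists_split hj
  rw [splice_eq ha, splice_eq ha, splice_eq hc]
  have : a ++ (c ++ y :: d) ++ b = (a ++ c) ++ y :: (d ++ b) := by simp
  rw [this, splice_eq (by simp [ha, hc])]
  simp

theorem splice_comm {α : Type*} (xs ys zs : List α) (i k : ℕ) (hk : k + 1 < xs.length)
    (hik : i ≤ k) :
    (xs.take i ++ ys ++ xs.drop (i + 1)).take (k + ys.length) ++ zs ++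
      (xs.take i ++ ys ++ xs.drop (i + 1)).drop (k + ys.length + 1) =
    (xs.take (k + 1) ++ zs ++ xs.drop (k + 1 + 1)).take i ++ ys ++
      (xs.take (k + 1) ++ zs ++ xs.drop (k + 1 + 1)).drop (i + 1) := by
  obtain ⟨a, x, b, rfl, ha⟩ := exists_split (show i < xs.length by omega)
  obtain ⟨c, y, d, rfl, hc⟩ := exists_split (show k - i < b.length by simp at hk; omega)
  have e : a ++ x :: (c ++ y :: d) = (a ++ x :: c) ++ y :: d := by simp
  have e' : a ++ ys ++ (c ++ y :: d) = (a ++ ys ++ c) ++ y :: d := by simp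
  rw [splice_eq ha, e', splice_eq (by simp [ha, hc]; omega), e,
    splice_eq (a := a ++ x :: c) (by simp [ha, hc]; omega)]
  have e'' : a ++ x :: c ++ zs ++ d = a ++ x :: (c ++ zs ++ d) := by simp
  rw [e'', splice_eq ha]
  simp
theorem splice_get_mid {α : Type*} (xs ys : List α) (i j : ℕ) (hi : i < xs.length)
    (hj : j < ys.length) : (xs.take i ++ ys ++ xs.drop (i + 1))[i + j]? = ys[j]? := by
  grind
theorem splice_get_right {α : Type*} (xs ys : List α) (i k : ℕ) (hi : k + 1 < xs.length)
    (hj : i ≤ k) : (xs.take i ++ ys ++ xs.drop (i + 1))[k + ys.length]? = xs[k+1]? := by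
  grind
theorem splice_get_left {α : Type*} (xs ys : List α) (i k : ℕ) (hi : k + 1 < xs.length)
    (hj : i ≤ k) : (xs.take (k+1) ++ ys ++ xs.drop (k+1 + 1))[i]? = xs[i]? := by
  grind

namespace PolygonData

variable {X : Type u} {L : Type v}

theorem forall₂_getElem {α β : Type*} {R : α → β → Prop} {l : List α} {l' : List β}
    (h : List.Forall₂ R l l') {i : ℕ} (hi : i < l.length) (hi' : i < l'.length) :
    R l[i] l'[i] := by
  have := (List.forall₂_iff_get.1 h).2 i hi hi'
  simpa using this

theorem forall₂_append {α β : Type*} {R : α → β → Prop} {l₁ l₂ : List α} {l₁' l₂' : List β}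
    (h₁ : List.Forall₂ R l₁ l₁') (h₂ : List.Forall₂ R l₂ l₂') :
    List.Forall₂ R (l₁ ++ l₂) (l₁' ++ l₂') :=
  List.rel_append h₁ h₂

/-- Gluing is compatible with isomorphisms. -/
def glueCongr {A A' B B' : PolygonData X L} (g : A.Iso A') (h : B.Iso B') (i : ℕ)
    (hi : i < A.inputs.length) (hi' : i < A'.inputs.length) :
    (A.glue i hi B).Iso (A'.glue i hi' B') where
  f := Equiv.sumCongr g.f h.f
  φ := Sum.elim g.φ h.φ
  moebius := by
    rintro (a | b)
    · exact g.moebius a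
    · exact h.moebius b
  disc_iff := by
    rintro (a | b)
    · exact g.disc_iff a
    · exact h.disc_iff b
  image_domain := by
    rintro (a | b)
    · exact g.image_domain a
    · exact h.image_domain b
  image_inner := by
    rintro (a | b)
    · exact g.image_inner a
    · exact h.image_inner b
  adj_iff := by
    have key := forall₂_getElem g.inputs_eq hi hi'
    rintro (a | b) (a' | b')
    · exact (glue_adj_ll _ _).trans ((g.adj_iff a a').trans (glue_adj_ll _ _).symm)
    · refine (glue_adj_lr _ _).trans (Iff.trans ?_ (glue_adj_lr _ _).symm)
      rw [key.1, h.out_eq.1, g.f.apply_eq_iff_eq, h.f.apply_eq_iff_eq]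
    · refine (glue_adj_rl _ _).trans (Iff.trans ?_ (glue_adj_rl _ _).symm)
      rw [key.1, h.out_eq.1, g.f.apply_eq_iff_eq, h.f.apply_eq_iff_eq]
    · exact (glue_adj_rr _ _).trans ((h.adj_iff b b').trans (glue_adj_rr _ _).symm)
  node_eq := by
    have key := forall₂_getElem g.inputs_eq hi hi'
    rintro (a | b) (a' | b') e
    · exact g.node_eq _ _ ((glue_adj_ll _ _).1 e)
    · obtain ⟨rfl, rfl⟩ := (glue_adj_lr _ _).1 e
      exact key.2
    · obtain ⟨rfl, rfl⟩ := (glue_adj_rl _ _).1 e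
      exact h.out_eq.2
    · exact h.node_eq _ _ ((glue_adj_rr _ _).1 e)
  out_eq := ⟨congrArg Sum.inl g.out_eq.1, g.out_eq.2⟩
  inputs_eq := by
    have hl : ∀ (l : List (A.C × Circle)) (l' : List (A'.C × Circle)),
        List.Forall₂ (fun p p' => p'.1 = g.f p.1 ∧ bpt p'.2 = g.φ p.1 (bpt p.2)) l l' →
        List.Forall₂ (fun (p : (A.C ⊕ B.C) × Circle) (p' : (A'.C ⊕ B'.C) × Circle) =>
          p'.1 = Equiv.sumCongr g.f h.f p.1 ∧
            bpt p'.2 = Sum.elim g.φ h.φ p.1 (bpt p.2))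
          (l.map (Prod.map Sum.inl id)) (l'.map (Prod.map Sum.inl id)) := by
      intro l l' e
      rw [List.forall₂_map_left_iff, List.forall₂_map_right_iff]
      exact e.imp fun p p' e => ⟨congrArg Sum.inl e.1, e.2⟩
    refine forall₂_append (forall₂_append (hl _ _ (List.forall₂_take i g.inputs_eq)) ?_)
      (hl _ _ (List.forall₂_drop (i + 1) g.inputs_eq))
    rw [List.forall₂_map_left_iff, List.forall₂_map_right_iff]
    exact h.inputs_eq.imp fun p p' e => ⟨congrArg Sum.inr e.1, e.2⟩
  map_eq := by
    rintro (a | b)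
    · exact g.map_eq a
    · exact h.map_eq b
  lift_eq := by
    rintro (a | b)
    · exact g.lift_eq a
    · exact h.lift_eq b

end PolygonData

namespace PolygonData

variable {X : Type u} {L : Type v}

/-- An isomorphism that is the identity on every component. -/
def Iso.ofEquiv {D D' : PolygonData X L} (f : D.C ≃ D'.C)
    (hdisc : ∀ α, f α ∈ D'.disc ↔ α ∈ D.disc)
    (hadj : ∀ α β, D'.G.Adj (f α) (f β) ↔ D.G.Adj α β)
    (hnode : ∀ α β, D.G.Adj α β → D'.node (f α) (f β) = D.node α β)
    (hout : D'.out = Prod.map f id D.out) (hin : D'.inputs = D.inputs.map (Prod.map f id))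
    (hmap : ∀ α, D'.map (f α) = D.map α) (h₁ : ∀ α, D'.liftIn (f α) = D.liftIn α)
    (h₂ : ∀ α, D'.liftOut (f α) = D.liftOut α) : D.Iso D' where
  f := f
  φ := fun _ => Equiv.refl _
  moebius := fun _ => ⟨1, fun z => by simp⟩
  disc_iff := hdisc
  image_domain := fun α => by
    ext z; simp [domain, hdisc]
  image_inner := fun α => by
    ext z; simp [inner, hdisc]
  adj_iff := hadj
  node_eq := hnode
  out_eq := by rw [hout]; exact ⟨rfl, rfl⟩
  inputs_eq := by
    rw [hin, List.forall₂_map_right_iff]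
    exact List.forall₂_same.2 fun _ _ => ⟨rfl, rfl⟩
  map_eq := fun α z _ => by rw [hmap]; rfl
  lift_eq := fun α _ z z' h => by
    have : z' = z := bpt_injective h
    subst this; rw [h₁, h₂]; exact ⟨rfl, rfl⟩

theorem glue_getElem_left {A B : PolygonData X L} {i k : ℕ} (hk : k + 1 < A.inputs.length) (hik : i ≤ k)
    (h : i < (A.glue (k + 1) hk B).inputs.length) :
    (A.glue (k + 1) hk B).inputs[i] = il A B (A.inputs[i]'(by omega)) := by
  have := splice_get_left (A.inputs.map (il A B)) (B.inputs.map (ir A B)) i k (by simpa) hik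
  rw [← List.map_take, ← List.map_drop] at this
  rw [← Option.some_inj, ← List.getElem?_eq_getElem]
  refine this.trans ?_
  simp [show i < A.inputs.length by omega]

section

variable {A B C : PolygonData X L} {i : ℕ} {hi : i < A.inputs.length}

theorem glue_getElem_mid {j : ℕ} (hj : j < B.inputs.length)
    (h : i + j < (A.glue i hi B).inputs.length) :
    (A.glue i hi B).inputs[i + j] = ir A B B.inputs[j] := by
  have := splice_get_mid (A.inputs.map (il A B)) (B.inputs.map (ir A B)) i j (by simpa) (by simpa)
  rw [← List.map_take, ← List.map_drop] at this
  rw [← Option.some_inj, ← List.getElem?_eq_getElem]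
  refine this.trans ?_
  simp [hj]

theorem glue_getElem_right {k : ℕ} (hk : k + 1 < A.inputs.length) (hik : i ≤ k)
    (h : k + B.inputs.length < (A.glue i hi B).inputs.length) :
    (A.glue i hi B).inputs[k + B.inputs.length] = il A B A.inputs[k + 1] := by
  have := splice_get_right (A.inputs.map (il A B)) (B.inputs.map (ir A B)) i k (by simpa) hik
  rw [← List.map_take, ← List.map_drop, List.length_map] at this
  rw [← Option.some_inj, ← List.getElem?_eq_getElem]
  refine this.trans ?_
  simp [hk]

/-- Gluing is associative. -/
def glueAssoc {j : ℕ} (hj : j < B.inputs.length) (h₁ : i + j < (A.glue i hi B).inputs.length) :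
    ((A.glue i hi B).glue (i + j) h₁ C).Iso (A.glue i hi (B.glue j hj C)) := by
  have key := glue_getElem_mid hj h₁
  refine Iso.ofEquiv (Equiv.sumAssoc A.C B.C C.C) ?_ ?_ ?_ rfl ?_ ?_ ?_ ?_
  · rintro ((a | b) | c) <;> exact Iff.rfl
  · rintro ((a | b) | c) ((a' | b') | c')
    · change (A.glue i hi (B.glue j hj C)).G.Adj (.inl a) (.inl a') ↔
        ((A.glue i hi B).glue (i + j) h₁ C).G.Adj (.inl (.inl a)) (.inl (.inl a'))
      rw [glue_adj_ll, glue_adj_ll, glue_adj_ll]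
    · change (A.glue i hi (B.glue j hj C)).G.Adj (.inl a) (.inr (.inl b')) ↔
        ((A.glue i hi B).glue (i + j) h₁ C).G.Adj (.inl (.inl a)) (.inl (.inr b'))
      rw [glue_adj_ll, glue_adj_lr, glue_adj_lr]; simp
    · change (A.glue i hi (B.glue j hj C)).G.Adj (.inl a) (.inr (.inr c')) ↔
        ((A.glue i hi B).glue (i + j) h₁ C).G.Adj (.inl (.inl a)) (.inr c')
      rw [glue_adj_lr, glue_adj_lr, key]; simp
    · change (A.glue i hi (B.glue j hj C)).G.Adj (.inr (.inl b)) (.inl a') ↔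
        ((A.glue i hi B).glue (i + j) h₁ C).G.Adj (.inl (.inr b)) (.inl (.inl a'))
      rw [glue_adj_ll, glue_adj_rl, glue_adj_rl]; simp
    · change (A.glue i hi (B.glue j hj C)).G.Adj (.inr (.inl b)) (.inr (.inl b')) ↔
        ((A.glue i hi B).glue (i + j) h₁ C).G.Adj (.inl (.inr b)) (.inl (.inr b'))
      rw [glue_adj_rr, glue_adj_ll, glue_adj_ll, glue_adj_rr]
    · change (A.glue i hi (B.glue j hj C)).G.Adj (.inr (.inl b)) (.inr (.inr c')) ↔
        ((A.glue i hi B).glue (i + j) h₁ C).G.Adj (.inl (.inr b)) (.inr c')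
      rw [glue_adj_rr, glue_adj_lr, glue_adj_lr, key]; simp
    · change (A.glue i hi (B.glue j hj C)).G.Adj (.inr (.inr c)) (.inl a') ↔
        ((A.glue i hi B).glue (i + j) h₁ C).G.Adj (.inr c) (.inl (.inl a'))
      rw [glue_adj_rl, glue_adj_rl, key]; simp
    · change (A.glue i hi (B.glue j hj C)).G.Adj (.inr (.inr c)) (.inr (.inl b')) ↔
        ((A.glue i hi B).glue (i + j) h₁ C).G.Adj (.inr c) (.inl (.inr b'))
      rw [glue_adj_rr, glue_adj_rl, glue_adj_rl, key]; simp
    · change (A.glue i hi (B.glue j hj C)).G.Adj (.inr (.inr c)) (.inr (.inr c')) ↔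
        ((A.glue i hi B).glue (i + j) h₁ C).G.Adj (.inr c) (.inr c')
      rw [glue_adj_rr, glue_adj_rr, glue_adj_rr]
  · rintro ((a | b) | c) ((a' | b') | c') h <;> try rfl
    · have := ((glue_adj_lr _ _).1 h).1
      rw [key] at this
      exact absurd this (by simp)
    · change bpt B.inputs[j].2 = bpt ((A.glue i hi B).inputs[i + j]).2
      rw [key]; rfl
    · have := ((glue_adj_rl _ _).1 h).1
      rw [key] at this
      exact absurd this (by simp)
  · have e := splice_assoc (A.inputs.map (Prod.map (Sum.inl (β := B.C ⊕ C.C)) id))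
      (B.inputs.map (Prod.map (Sum.inr (α := A.C) ∘ Sum.inl (β := C.C)) id))
      (C.inputs.map (Prod.map (Sum.inr (α := A.C) ∘ Sum.inr (α := B.C)) id)) i j
      (by simpa) (by simpa)
    simp only [List.map_append, List.map_take, List.map_drop, List.map_map] at e ⊢
    exact e.symm
  · rintro ((a | b) | c) <;> rfl
  · rintro ((a | b) | c) <;> rfl
  · rintro ((a | b) | c) <;> rfl

/-- Exchange of the last two summands. -/
def sumSwap (α β γ : Type*) : (α ⊕ β) ⊕ γ ≃ (α ⊕ γ) ⊕ β where
  toFun := fun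
    | .inl (.inl a) => .inl (.inl a)
    | .inl (.inr b) => .inr b
    | .inr c => .inl (.inr c)
  invFun := fun
    | .inl (.inl a) => .inl (.inl a)
    | .inl (.inr c) => .inr c
    | .inr b => .inl (.inr b)
  left_inv := by rintro ((a | b) | c) <;> rfl
  right_inv := by rintro ((a | b) | c) <;> rfl

/-- Gluings at different inputs commute. -/
def glueComm {k : ℕ} (hk : k + 1 < A.inputs.length) (hik : i ≤ k)
    (h₁ : k + B.inputs.length < (A.glue i hi B).inputs.length)
    (h₂ : i < (A.glue (k + 1) hk C).inputs.length) :
    ((A.glue i hi B).glue (k + B.inputs.length) h₁ C).Iso ((A.glue (k + 1) hk C).glue i h₂ B) := by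
  have key := glue_getElem_right (B := B) hk hik h₁
  have key' := glue_getElem_left (B := C) hk hik h₂
  refine Iso.ofEquiv (sumSwap A.C B.C C.C) ?_ ?_ ?_ rfl ?_ ?_ ?_ ?_
  · rintro ((a | b) | c) <;> exact Iff.rfl
  · rintro ((a | b) | c) ((a' | b') | c')
    · change ((A.glue (k + 1) hk C).glue i h₂ B).G.Adj (.inl (.inl a)) (.inl (.inl a')) ↔
        ((A.glue i hi B).glue (k + B.inputs.length) h₁ C).G.Adj (.inl (.inl a)) (.inl (.inl a'))
      rw [glue_adj_ll, glue_adj_ll, glue_adj_ll, glue_adj_ll]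
    · change ((A.glue (k + 1) hk C).glue i h₂ B).G.Adj (.inl (.inl a)) (.inr b') ↔
        ((A.glue i hi B).glue (k + B.inputs.length) h₁ C).G.Adj (.inl (.inl a)) (.inl (.inr b'))
      rw [glue_adj_lr, glue_adj_ll, glue_adj_lr, key']; simp
    · change ((A.glue (k + 1) hk C).glue i h₂ B).G.Adj (.inl (.inl a)) (.inl (.inr c')) ↔
        ((A.glue i hi B).glue (k + B.inputs.length) h₁ C).G.Adj (.inl (.inl a)) (.inr c')
      rw [glue_adj_ll, glue_adj_lr, glue_adj_lr, key]; simp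
    · change ((A.glue (k + 1) hk C).glue i h₂ B).G.Adj (.inr b) (.inl (.inl a')) ↔
        ((A.glue i hi B).glue (k + B.inputs.length) h₁ C).G.Adj (.inl (.inr b)) (.inl (.inl a'))
      rw [glue_adj_rl, glue_adj_ll, glue_adj_rl, key']; simp
    · change ((A.glue (k + 1) hk C).glue i h₂ B).G.Adj (.inr b) (.inr b') ↔
        ((A.glue i hi B).glue (k + B.inputs.length) h₁ C).G.Adj (.inl (.inr b)) (.inl (.inr b'))
      rw [glue_adj_rr, glue_adj_ll, glue_adj_rr]
    · change ((A.glue (k + 1) hk C).glue i h₂ B).G.Adj (.inr b) (.inl (.inr c')) ↔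
        ((A.glue i hi B).glue (k + B.inputs.length) h₁ C).G.Adj (.inl (.inr b)) (.inr c')
      rw [glue_adj_rl, glue_adj_lr, key, key']; simp
    · change ((A.glue (k + 1) hk C).glue i h₂ B).G.Adj (.inl (.inr c)) (.inl (.inl a')) ↔
        ((A.glue i hi B).glue (k + B.inputs.length) h₁ C).G.Adj (.inr c) (.inl (.inl a'))
      rw [glue_adj_ll, glue_adj_rl, glue_adj_rl, key]; simp
    · change ((A.glue (k + 1) hk C).glue i h₂ B).G.Adj (.inl (.inr c)) (.inr b') ↔
        ((A.glue i hi B).glue (k + B.inputs.length) h₁ C).G.Adj (.inr c) (.inl (.inr b'))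
      rw [glue_adj_lr, glue_adj_rl, key, key']; simp
    · change ((A.glue (k + 1) hk C).glue i h₂ B).G.Adj (.inl (.inr c)) (.inl (.inr c')) ↔
        ((A.glue i hi B).glue (k + B.inputs.length) h₁ C).G.Adj (.inr c) (.inr c')
      rw [glue_adj_ll, glue_adj_rr, glue_adj_rr]
  · rintro ((a | b) | c) ((a' | b') | c') h <;> try rfl
    · change bpt ((A.glue (k + 1) hk C).inputs[i]).2 = bpt A.inputs[i].2
      rw [key']; rfl
    · change bpt A.inputs[k + 1].2 = bpt ((A.glue i hi B).inputs[k + B.inputs.length]).2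
      rw [key]; rfl
    · have := ((glue_adj_lr _ _).1 h).1
      rw [key] at this
      exact absurd this (by simp)
    · have := ((glue_adj_rl _ _).1 h).1
      rw [key] at this
      exact absurd this (by simp)
  · have e := splice_comm (A.inputs.map (Prod.map (Sum.inl (β := B.C) ∘ Sum.inl (β := C.C)) id))
      (B.inputs.map (Prod.map (Sum.inr (α := A.C ⊕ C.C)) id))
      (C.inputs.map (Prod.map (Sum.inl (β := B.C) ∘ Sum.inr (α := A.C)) id)) i k
      (by simpa) hik
    simp only [List.map_append, List.map_take, List.map_drop, List.map_map, List.length_map] at e ⊢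
    exact e.symm
  · rintro ((a | b) | c) <;> rfl
  · rintro ((a | b) | c) <;> rfl
  · rintro ((a | b) | c) <;> rfl

end

end PolygonData

theorem IsEdgePath.map {V E F : Type*} {s t : E → V} {s' t' : F → V} (f : F → E)
    (hs : ∀ e, s (f e) = s' e) (ht : ∀ e, t (f e) = t' e) {l : List F} {v w : V}
    (h : IsEdgePath s t v (l.map f) w) : IsEdgePath s' t' v l w := by
  induction l generalizing v with
  | nil => exact h
  | cons e l ih =>
    obtain ⟨h₁, h₂⟩ := h
    rw [ht] at h₂
    exact ⟨(hs e).symm.trans h₁, ih h₂⟩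

theorem mk_eq_of_joined {L : Type*} [TopologicalSpace L] {x y : L} (h : Joined x y) :
    ZerothHomotopy.mk x = ZerothHomotopy.mk y :=
  Quotient.sound h

namespace PolygonData

section

variable {X : Type u} {L : Type v}

/-- The pair of one-sided limits of the lift at an incoming boundary marked point. -/
def evIn (D : PolygonData X L) (p : D.C × Circle) : L × L :=
  (D.liftIn p.1 p.2, D.liftOut p.1 p.2)

/-- The pair of one-sided limits of the lift at the outgoing boundary marked point. -/
def evOut (D : PolygonData X L) : L × L :=
  (D.liftOut D.out.1 D.out.2, D.liftIn D.out.1 D.out.2)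

theorem Iso.evOut_eq {D D' : PolygonData X L} (g : D.Iso D') (hD : D.out.1 ∈ D.disc) :
    D'.evOut = D.evOut := by
  have := g.lift_eq _ hD D.out.2 D'.out.2 g.out_eq.2
  rw [← g.out_eq.1] at this
  exact Prod.ext this.2 this.1

theorem Iso.evIn_eq {D D' : PolygonData X L} (g : D.Iso D') (hD : ∀ p ∈ D.inputs, p.1 ∈ D.disc) :
    D'.inputs.map D'.evIn = D.inputs.map D.evIn := by
  have key : ∀ (l : List (D.C × Circle)) (l' : List (D'.C × Circle)),
      List.Forall₂ (fun p p' => p'.1 = g.f p.1 ∧ bpt p'.2 = g.φ p.1 (bpt p.2)) l l' →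
      (∀ p ∈ l, p.1 ∈ D.disc) → l'.map D'.evIn = l.map D.evIn := by
    intro l l' h
    induction h with
    | nil => intro _; rfl
    | @cons p p' l l' h _ ih =>
      intro hl
      rw [List.map_cons, List.map_cons, ih fun x hx => hl x (by simp [hx])]
      have := g.lift_eq _ (hl p (by simp)) p.2 p'.2 h.2
      rw [← h.1] at this
      rw [show D'.evIn p' = D.evIn p from Prod.ext this.1 this.2]
  exact key _ _ g.inputs_eq hD

end

variable {X : Type u} {L : Type v} [TopologicalSpace X] [TopologicalSpace L] {d : ℕ}
  [ChartedSpace (EuclideanSpace ℝ (Fin d)) X] [IsManifold (𝓡 d) ∞ X]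
  {J : AlmostComplexStructure (d := d) X} {ι : L → X}

theorem IsStable.joined_arc {D : PolygonData X L} (hD : D.IsStable J ι) {p q : D.C × Circle}
    (hp : p.1 ∈ D.disc) (h : D.Next p q) :
    Joined (D.liftOut p.1 p.2) (D.liftIn q.1 q.2) := by
  obtain ⟨α, z⟩ := p
  obtain ⟨α', z'⟩ := q
  obtain ⟨e, -, θ, hθ, e', hno⟩ := h
  simp only at e e' hno hp ⊢
  subst e e'
  classical
  obtain ⟨γ, hγ⟩ : ∃ γ : ℝ → L, γ = fun t => if t ≤ 0 then D.liftOut α' z else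
    D.liftIn α' (Circle.exp t * z) := ⟨_, rfl⟩
  have hpos : ∀ t, 0 < t → γ t = D.liftIn α' (Circle.exp t * z) := fun t ht => by
    rw [hγ]; exact if_neg (not_le.2 ht)
  have hpos' : ∀ t, 0 < t → t < θ → γ t = D.liftOut α' (Circle.exp t * z) := fun t ht ht' => by
    rw [hpos t ht, hD.lift_eq _ hp _ (hno t ⟨ht, ht'⟩)]
  have h0 : γ 0 = D.liftOut α' z := by rw [hγ]; exact if_pos le_rfl
  have hnn : ∀ t, 0 ≤ t → t < θ → γ t = D.liftOut α' (Circle.exp t * z) := fun t ht ht' => by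
    rcases ht.eq_or_lt with rfl | ht
    · rw [h0]; simp
    · exact hpos' t ht ht'
  have hshift : ∀ t t', Circle.exp (t' - t) * (Circle.exp t * z) = Circle.exp t' * z := by
    intro t t'
    rw [← mul_assoc, ← Circle.exp_add]; simp
  have hc : ContinuousOn γ (Set.Icc 0 θ) := by
    intro t ht
    have hl : ContinuousWithinAt γ (Set.Icc 0 θ ∩ Set.Iio t) t := by
      rcases ht.1.eq_or_lt with rfl | h0t
      · have : Set.Icc (0 : ℝ) θ ∩ Set.Iio 0 = ∅ := by
          ext x; simp +contextual
        rw [this]; simp [ContinuousWithinAt]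
      · refine ContinuousWithinAt.mono (t := Set.Iio t) ?_ Set.inter_subset_right
        have k := (hD.lift_tendsto α' hp (Circle.exp t * z)).1
        have k' : Filter.Tendsto (fun t' : ℝ => t' - t) (𝓝[<] t) (𝓝[<] 0) := by
          refine tendsto_nhdsWithin_iff.2 ⟨?_, ?_⟩
          · have : Filter.Tendsto (fun t' : ℝ => t' - t) (𝓝 t) (𝓝 (t - t)) :=
              (continuous_sub_right t).tendsto t
            rw [sub_self] at this
            exact this.mono_left nhdsWithin_le_nhds
          · filter_upwards [self_mem_nhdsWithin] with x hx using sub_neg.2 (Set.mem_Iio.1 hx)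
        have k'' := k.comp k'
        rw [← hpos t h0t] at k''
        refine k''.congr' ?_
        filter_upwards [nhdsWithin_le_nhds (Ioi_mem_nhds h0t)] with x hx
        simp only [Function.comp]
        rw [hshift, hpos x hx]
    have hr : ContinuousWithinAt γ (Set.Icc 0 θ ∩ Set.Ioi t) t := by
      rcases ht.2.eq_or_lt with rfl | htθ
      · have : Set.Icc (0 : ℝ) t ∩ Set.Ioi t = ∅ := by
          ext x; simp +contextual
        rw [this]; simp [ContinuousWithinAt]
      · refine ContinuousWithinAt.mono (t := Set.Ioi t) ?_ Set.inter_subset_right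
        have k := (hD.lift_tendsto α' hp (Circle.exp t * z)).2
        have k' : Filter.Tendsto (fun t' : ℝ => t' - t) (𝓝[>] t) (𝓝[>] 0) := by
          refine tendsto_nhdsWithin_iff.2 ⟨?_, ?_⟩
          · have : Filter.Tendsto (fun t' : ℝ => t' - t) (𝓝 t) (𝓝 (t - t)) :=
              (continuous_sub_right t).tendsto t
            rw [sub_self] at this
            exact this.mono_left nhdsWithin_le_nhds
          · filter_upwards [self_mem_nhdsWithin] with x hx using sub_pos.2 (Set.mem_Ioi.1 hx)
        have k'' := k.comp k'
        rw [← hnn t ht.1 htθ] at k''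
        refine k''.congr' ?_
        filter_upwards [nhdsWithin_le_nhds (Iio_mem_nhds htθ), self_mem_nhdsWithin] with x hx hx'
        simp only [Function.comp]
        rw [hshift, hpos' x (lt_of_le_of_lt ht.1 hx') hx]
    have hs : ContinuousWithinAt γ {t} t := continuousWithinAt_singleton
    refine ((hl.union hs).union hr).mono ?_
    intro x hx
    rcases lt_trichotomy x t with h | h | h
    · exact .inl (.inl ⟨hx, h⟩)
    · exact .inl (.inr h)
    · exact .inr ⟨hx, h⟩
  have hpc : IsPathConnected (Set.Icc (0 : ℝ) θ) :=
    (convex_Icc 0 θ).isPathConnected ⟨0, le_rfl, hθ.1.le⟩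
  have := (hpc.image' hc).joinedIn (γ 0) ⟨0, ⟨le_rfl, hθ.1.le⟩, rfl⟩ (γ θ)
    ⟨θ, ⟨hθ.1.le, le_rfl⟩, rfl⟩
  rw [h0, hpos θ hθ.1] at this
  exact this.joined

theorem IsStable.glued_disc {D : PolygonData X L} (hD : D.IsStable J ι) {p q : D.C × Circle}
    (hp : p.1 ∈ D.disc) (h : D.Glued p q) : q.1 ∈ D.disc := by
  by_contra hq
  have := hD.node_inner p.1 q.1 h.1 (fun h => hq h.2)
  rw [← h.2.1] at this
  exact bpt_notMem_openDisc _ (this hp)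

theorem IsStable.isEdgePath_aux {D : PolygonData X L} (hD : D.IsStable J ι)
    (m : List (D.C × Circle)) : ∀ (p : D.C × Circle) (ins : List (D.C × Circle))
    (a : L), List.IsChain D.Step (p :: m ++ [D.out]) →
    (p ∈ D.out :: D.inputs → a = D.liftOut p.1 p.2) →
    (p ∉ D.out :: D.inputs → Joined a (D.liftIn p.1 p.2)) →
    p.1 ∈ D.disc → (∀ q ∈ m, q.1 ∈ D.disc) → m.Nodup → ins.Sublist m →
    (∀ q ∈ m, q ∈ D.out :: D.inputs ↔ q ∈ ins) →
    IsEdgePath (fun e : L × L => ZerothHomotopy.mk e.1)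
      (fun e => ZerothHomotopy.mk e.2)
      (ZerothHomotopy.mk a) (ins.map D.evIn)
      (ZerothHomotopy.mk (D.liftIn D.out.1 D.out.2)) := by
  have key : ∀ (p q : D.C × Circle) (a : L), D.Step p q →
      (p ∈ D.out :: D.inputs → a = D.liftOut p.1 p.2) →
      (p ∉ D.out :: D.inputs → Joined a (D.liftIn p.1 p.2)) → p.1 ∈ D.disc →
      Joined a (D.liftIn q.1 q.2) := by
    intro p q a h h₁ h₂ hp
    by_cases hm : p ∈ D.out :: D.inputs
    · rw [h₁ hm]
      exact hD.joined_arc hp (hD.step_marked hm h)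
    · rcases h with ⟨h, -⟩ | ⟨p', hg, hn⟩
      · exact absurd h hm
      · have hp' := hD.glued_disc hp hg
        refine (h₂ hm).trans ?_
        rw [hD.lift_node p p' hg hp hp']
        exact hD.joined_arc hp' hn
  induction m with
  | nil =>
    intro p ins a hc h₁ h₂ hp _ _ hs _
    rw [List.sublist_nil] at hs
    subst hs
    simp only [List.cons_append, List.nil_append, List.isChain_cons_cons] at hc
    exact mk_eq_of_joined (key p _ a hc.1 h₁ h₂ hp)
  | cons q m ih =>
    intro p ins a hc h₁ h₂ hp hm hnd hs hins
    simp only [List.cons_append, List.isChain_cons_cons] at hc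
    have hj := key p q a hc.1 h₁ h₂ hp
    have hq := hm q (by simp)
    have hm' : ∀ x ∈ m, x.1 ∈ D.disc := fun x hx => hm x (by simp [hx])
    rw [List.nodup_cons] at hnd
    have hins' := hins q (by simp)
    by_cases hqm : q ∈ ins
    · cases hs with
      | cons _ hs => exact absurd (hs.subset hqm) hnd.1
      | cons_cons _ hs =>
        rename_i ins
        refine ⟨mk_eq_of_joined hj.symm, ih q ins _ hc.2 (fun _ => rfl) (fun h => ?_) hq hm' hnd.2
          hs fun x hx => ?_⟩
        · exact absurd (hins'.2 hqm) h
        · have hxq : x ≠ q := by rintro rfl; exact hnd.1 hx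
          rw [hins x (by simp [hx])]
          simp [hxq]
    · have hs' : ins.Sublist m := by
        cases hs with
        | cons _ hs => exact hs
        | cons_cons _ hs => exact absurd (by simp) hqm
      exact ih q ins a hc.2 (fun h => absurd (hins'.1 h) hqm) (fun _ => hj) hq hm' hnd.2 hs'
        fun x hx => hins x (by simp [hx])

theorem IsStable.isEdgePath {D : PolygonData X L} (hD : D.IsStable J ι) :
    IsEdgePath (fun e : L × L => ZerothHomotopy.mk e.1)
      (fun e => ZerothHomotopy.mk e.2)
      (ZerothHomotopy.mk D.evOut.1) (D.inputs.map D.evIn)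
      (ZerothHomotopy.mk D.evOut.2) := by
  obtain ⟨l, hnd, hmem, hch, hs⟩ := hD.order
  rw [List.nodup_cons] at hnd
  refine hD.isEdgePath_aux l D.out D.inputs _ hch (fun _ => rfl) (fun h => absurd (by simp) h)
    hD.out_disc (fun q hq => ((hmem q).1 (by simp [hq])).1) hnd.2 hs fun q hq => ?_
  have : q ≠ D.out := by rintro rfl; exact hnd.1 hq
  simp [this]

end PolygonData

/-! ### The moduli fc-multicategory -/

section Moduli

variable {X : Type u} {L : Type v} [TopologicalSpace X] [TopologicalSpace L] {d : ℕ}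
  [ChartedSpace (EuclideanSpace ℝ (Fin d)) X] [IsManifold (𝓡 d) ∞ X]

/-- The fibre product `L ×_X L`. -/
abbrev Edge {X : Type u} {L : Type v} (ι : L → X) : Type v := {p : L × L // ι p.1 = ι p.2}

/-- `J`-holomorphic stable polygons with boundary on `ι`. -/
abbrev StablePolygon (J : AlmostComplexStructure (d := d) X) (ι : L → X) : Type (max u v 1) :=
  {D : PolygonData X L // D.IsStable J ι}

variable {J : AlmostComplexStructure (d := d) X} {ι : L → X}

namespace StablePolygon

/-- Isomorphism of stable polygons. -/
instance setoid (J : AlmostComplexStructure (d := d) X) (ι : L → X) :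
    Setoid (StablePolygon J ι) where
  r P Q := Nonempty (P.1.Iso Q.1)
  iseqv := ⟨fun P => ⟨.refl P.1⟩, fun ⟨g⟩ => ⟨g.symm⟩, fun ⟨g⟩ ⟨h⟩ => ⟨g.trans h⟩⟩

/-- The evaluation at the outgoing boundary marked point. -/
def cod (P : StablePolygon J ι) : Edge ι :=
  ⟨P.1.evOut, ((P.2.lift_map _ P.2.out_disc _).2).trans (P.2.lift_map _ P.2.out_disc _).1.symm⟩

/-- The evaluations at the incoming boundary marked points. -/
def dom (P : StablePolygon J ι) : List (Edge ι) :=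
  P.1.inputs.pmap (fun p hp => ⟨P.1.evIn p, (P.2.lift_map p.1 hp p.2).1.trans
    (P.2.lift_map p.1 hp p.2).2.symm⟩) P.2.inputs_disc

theorem map_dom (P : StablePolygon J ι) : P.dom.map Subtype.val = P.1.inputs.map P.1.evIn := by
  rw [dom, List.map_pmap, List.pmap_eq_map]

theorem cod_eq {P Q : StablePolygon J ι} (h : P ≈ Q) : P.cod = Q.cod := by
  obtain ⟨g⟩ := h
  exact Subtype.ext (g.evOut_eq P.2.out_disc).symm

theorem dom_eq {P Q : StablePolygon J ι} (h : P ≈ Q) : P.dom = Q.dom := by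
  obtain ⟨g⟩ := h
  apply (List.map_injective_iff.2 Subtype.val_injective)
  rw [map_dom, map_dom, g.evIn_eq P.2.inputs_disc]

theorem lt_of_eq {P Q : StablePolygon J ι} {i : ℕ} (h : P.dom[i]? = some Q.cod) :
    i < P.1.inputs.length := by
  obtain ⟨hi, -⟩ := List.getElem?_eq_some_iff.1 h
  simpa [dom] using hi

theorem evIn_eq {P Q : StablePolygon J ι} {i : ℕ} (h : P.dom[i]? = some Q.cod) :
    P.1.evIn (P.1.inputs[i]'(lt_of_eq h)) = Q.1.evOut := by
  obtain ⟨hi, h⟩ := List.getElem?_eq_some_iff.1 h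
  have := congrArg Subtype.val h
  simpa [dom, cod] using this

/-- Gluing of stable polygons with matching evaluations. -/
def glue (P : StablePolygon J ι) (i : ℕ) (Q : StablePolygon J ι) (h : P.dom[i]? = some Q.cod) :
    StablePolygon J ι :=
  ⟨P.1.glue i (lt_of_eq h) Q.1, P.2.glue Q.2 (congrArg Prod.fst (evIn_eq h))
    (congrArg Prod.snd (evIn_eq h))⟩

theorem cod_glue (P : StablePolygon J ι) (i : ℕ) (Q : StablePolygon J ι)
    (h : P.dom[i]? = some Q.cod) : (P.glue i Q h).cod = P.cod := rfl

theorem dom_glue (P : StablePolygon J ι) (i : ℕ) (Q : StablePolygon J ι)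
    (h : P.dom[i]? = some Q.cod) :
    (P.glue i Q h).dom = P.dom.take i ++ Q.dom ++ P.dom.drop (i + 1) := by
  apply (List.map_injective_iff.2 Subtype.val_injective)
  simp only [List.map_append, List.map_take, List.map_drop, map_dom]
  simp only [glue, List.map_append, List.map_take, List.map_drop, List.map_map]
  rfl

theorem glue_congr {P P' Q Q' : StablePolygon J ι} (hP : P ≈ P') (hQ : Q ≈ Q') (i : ℕ)
    (h : P.dom[i]? = some Q.cod) (h' : P'.dom[i]? = some Q'.cod) :
    P.glue i Q h ≈ P'.glue i Q' h' := by
  obtain ⟨g⟩ := hP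
  obtain ⟨k⟩ := hQ
  exact ⟨PolygonData.glueCongr g k i _ _⟩

theorem isEdgePath (P : StablePolygon J ι) :
    IsEdgePath (fun e : Edge ι => ZerothHomotopy.mk e.1.1) (fun e => ZerothHomotopy.mk e.1.2)
      (ZerothHomotopy.mk P.cod.1.1) P.dom (ZerothHomotopy.mk P.cod.1.2) := by
  have := P.2.isEdgePath
  rw [← map_dom] at this
  exact this.map _ (fun _ => rfl) (fun _ => rfl)

end StablePolygon

/-- The 2-cells: formal identities of the 1-cells, and isomorphism classes of stable polygons. -/
inductive ModuliCell (J : AlmostComplexStructure (d := d) X) (ι : L → X) : Type (max u v 1)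
  | unit (e : Edge ι) : ModuliCell J ι
  | polygon (a : Quotient (StablePolygon.setoid J ι)) : ModuliCell J ι

namespace ModuliCell

/-- The outgoing evaluation. -/
def cod : ModuliCell J ι → Edge ι
  | unit e => e
  | polygon a => a.lift StablePolygon.cod fun _ _ h => StablePolygon.cod_eq h

/-- The incoming evaluations. -/
def dom : ModuliCell J ι → List (Edge ι)
  | unit e => [e]
  | polygon a => a.lift StablePolygon.dom fun _ _ h => StablePolygon.dom_eq h

/-- The class of a stable polygon. -/
abbrev mk (P : StablePolygon J ι) : ModuliCell J ι := polygon (Quotient.mk _ P)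

theorem matching {a b : Quotient (StablePolygon.setoid J ι)} {i : ℕ}
    (h : (polygon a).dom[i]? = some (polygon b).cod) : a.out.dom[i]? = some b.out.cod := by
  conv at h => rw [← Quotient.out_eq a, ← Quotient.out_eq b]
  exact h

/-- Composition: gluing of representatives. -/
noncomputable def comp : (a : ModuliCell J ι) → (i : ℕ) → (b : ModuliCell J ι) →
    a.dom[i]? = some b.cod → ModuliCell J ι
  | unit _, _, b, _ => b
  | polygon a, _, unit _, _ => polygon a
  | polygon a, i, polygon b, h => mk (a.out.glue i b.out (matching h))

theorem mk_comp (P : StablePolygon J ι) (i : ℕ) (Q : StablePolygon J ι)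
    (h : (mk P).dom[i]? = some (mk Q).cod) : (mk P).comp i (mk Q) h = mk (P.glue i Q h) := by
  rw [comp]
  refine congrArg polygon (Quotient.sound ?_)
  exact StablePolygon.glue_congr (Quotient.mk_out P) (Quotient.mk_out Q) i _ _

theorem exists_mk (a : Quotient (StablePolygon.setoid J ι)) :
    ∃ P : StablePolygon J ι, polygon a = mk P := by
  obtain ⟨P, rfl⟩ := Quotient.exists_rep a
  exact ⟨P, rfl⟩

end ModuliCell

/-- The moduli fc-multicategory of `ι : L → X`: its 0-cells are the path components of `L`, its
1-cells the points of `L ×_X L`, its 2-cells the (isomorphism classes of) `J`-holomorphic stable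
polygons, together with an identity 2-cell for every 1-cell, lying over their evaluations at the
boundary marked points, and its composition is gluing at boundary marked points. -/
noncomputable def moduli (J : AlmostComplexStructure (d := d) X) (ι : L → X) :
    VDFcMulticategory.{v, v, max u v 1} where
  V := ZerothHomotopy L
  E := Edge ι
  Cell := ModuliCell J ι
  s e := ZerothHomotopy.mk e.1.1
  t e := ZerothHomotopy.mk e.1.2
  dom := ModuliCell.dom
  cod := ModuliCell.cod
  profile := by
    rintro (e | a)
    · exact ⟨rfl, rfl⟩
    · obtain ⟨P, h⟩ := ModuliCell.exists_mk a
      rw [h]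
      exact P.isEdgePath
  unit := ModuliCell.unit
  dom_unit _ := rfl
  cod_unit _ := rfl
  comp := ModuliCell.comp
  dom_comp := by
    rintro (e | a) i b h
    · obtain ⟨hi, h⟩ := List.getElem?_eq_some_iff.1 h
      obtain rfl : i = 0 := by simpa [ModuliCell.dom] using hi
      simp [ModuliCell.comp, ModuliCell.dom]
    · rcases b with e | b
      · obtain ⟨hi, h⟩ := List.getElem?_eq_some_iff.1 h
        change (ModuliCell.polygon a).dom = List.take i (ModuliCell.polygon a).dom ++ [e] ++
          List.drop (i + 1) (ModuliCell.polygon a).dom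
        rw [show e = (ModuliCell.polygon a).dom[i] from h.symm]
        simp
      · obtain ⟨P, hP⟩ := ModuliCell.exists_mk a
        obtain ⟨Q, hQ⟩ := ModuliCell.exists_mk b
        revert h
        rw [hP, hQ]
        intro h
        rw [ModuliCell.mk_comp]
        exact StablePolygon.dom_glue P i Q h
  cod_comp := by
    rintro (e | a) i b h
    · obtain ⟨hi, h⟩ := List.getElem?_eq_some_iff.1 h
      obtain rfl : i = 0 := by simpa [ModuliCell.dom] using hi
      exact h.symm
    · rcases b with e | b
      · rfl
      · obtain ⟨P, hP⟩ := ModuliCell.exists_mk a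
        obtain ⟨Q, hQ⟩ := ModuliCell.exists_mk b
        revert h
        rw [hP, hQ]
        intro h
        rw [ModuliCell.mk_comp]
        exact StablePolygon.cod_glue P i Q h
  unit_comp _ _ _ := rfl
  comp_unit := by
    rintro (e | a) i e' h
    · obtain ⟨hi, h⟩ := List.getElem?_eq_some_iff.1 h
      obtain rfl : i = 0 := by simpa [ModuliCell.dom] using hi
      exact congrArg ModuliCell.unit h.symm
    · rfl
  assoc := by
    rintro (e | a) i b j c h₁ h₂ h₃ h₄
    · obtain ⟨hi, -⟩ := List.getElem?_eq_some_iff.1 h₁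
      obtain rfl : i = 0 := by simpa [ModuliCell.dom] using hi
      have : ∀ k (_ : k = j) h, b.comp k c h = b.comp j c h₂ := by rintro _ rfl _; rfl
      exact this _ (Nat.zero_add j) _
    · rcases b with e | b
      · obtain ⟨hj, -⟩ := List.getElem?_eq_some_iff.1 h₂
        obtain rfl : j = 0 := by simpa [ModuliCell.dom] using hj
        rfl
      · rcases c with e | c
        · rfl
        · obtain ⟨P, hP⟩ := ModuliCell.exists_mk a
          obtain ⟨Q, hQ⟩ := ModuliCell.exists_mk b
          obtain ⟨R, hR⟩ := ModuliCell.exists_mk c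
          revert h₁ h₂ h₃ h₄
          rw [hP, hQ, hR]
          intro h₁ h₂ h₃ h₄
          revert h₃ h₄
          rw [ModuliCell.mk_comp, ModuliCell.mk_comp]
          intro h₃ h₄
          rw [ModuliCell.mk_comp, ModuliCell.mk_comp]
          exact congrArg ModuliCell.polygon (Quotient.sound
            ⟨PolygonData.glueAssoc (StablePolygon.lt_of_eq h₂) (StablePolygon.lt_of_eq h₃)⟩)
  comm := by
    rintro (e | a) i b k c h₁ h₂ h₃ h₄ hik
    · obtain ⟨hk, -⟩ := List.getElem?_eq_some_iff.1 h₂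
      simp [ModuliCell.dom] at hk
    · rcases b with e | b
      · rcases c with e' | c <;> rfl
      · rcases c with e | c
        · rfl
        · obtain ⟨P, hP⟩ := ModuliCell.exists_mk a
          obtain ⟨Q, hQ⟩ := ModuliCell.exists_mk b
          obtain ⟨R, hR⟩ := ModuliCell.exists_mk c
          have hl : (ModuliCell.polygon b).dom.length = Q.1.inputs.length := by
            rw [hQ]
            simp [ModuliCell.dom, StablePolygon.dom]
          revert h₁ h₂ h₃ h₄
          rw [hl, hP, hQ, hR]
          intro h₁ h₂ h₃ h₄
          revert h₃ h₄
          rw [ModuliCell.mk_comp, ModuliCell.mk_comp]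
          intro h₃ h₄
          rw [ModuliCell.mk_comp, ModuliCell.mk_comp]
          exact congrArg ModuliCell.polygon (Quotient.sound
            ⟨PolygonData.glueComm (StablePolygon.lt_of_eq h₂) hik (StablePolygon.lt_of_eq h₃)
              (StablePolygon.lt_of_eq h₄)⟩)

end Moduli

/-! ### Families of Lagrangians -/

/-- The index set `{0, …, N}`, where `N = ∞` is allowed (then it is the set of all naturals). -/
abbrev Index (N : ℕ∞) : Type := {v : ℕ // (v : ℕ∞) ≤ N}

/-- The inclusion `{0, …, M} ⊆ {0, …, N}`. -/
def Index.incl {M N : ℕ∞} (h : M ≤ N) (v : Index M) : Index N := ⟨v.1, v.2.trans h⟩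

/-- The disjoint union of a family of subsets. -/
abbrev Total {X : Type u} {A : Type} (L : A → Set X) : Type u := Σ a, L a

/-- The map `⊔ L a → X` given by the inclusions. -/
def Total.toBase {X : Type u} {A : Type} (L : A → Set X) (p : Total L) : X := p.2

/-- The inclusion of the disjoint union of a subfamily. -/
def Total.incl {X : Type u} {A B : Type} (L : B → Set X) (f : A → B)
    (p : Total fun a => L (f a)) : Total L := ⟨f p.1, p.2⟩

/-- `F` is the map of moduli fc-multicategories induced by a map `j : L' → L` over `X`: it is
`π₀ j` on 0-cells, `j × j` on 1-cells, and composition of the lift of the boundary values with `j` on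
polygons. -/
structure IsInducedBy {X : Type u} {L' L : Type v} [TopologicalSpace X] [TopologicalSpace L']
    [TopologicalSpace L] {d : ℕ} [ChartedSpace (EuclideanSpace ℝ (Fin d)) X]
    [IsManifold (𝓡 d) ∞ X] {J : AlmostComplexStructure (d := d) X} {ι' : L' → X} {ι : L → X}
    (F : FcMap (moduli J ι') (moduli J ι)) (j : L' → L) : Prop where
  onV_eq : ∀ x : L', F.onV (ZerothHomotopy.mk x) = ZerothHomotopy.mk (j x)
  onE_eq : ∀ e : Edge ι', (F.onE e : Edge ι).1 = (j e.1.1, j e.1.2)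
  onCell_eq : ∀ P : StablePolygon J ι', ∃ h : (P.1.push j).IsStable J ι,
    F.onCell (ModuliCell.mk P) = ModuliCell.mk ⟨P.1.push j, h⟩

end FcModuli

/-! The inclusion `j : L' → L` selects some summands of a topological disjoint union. Hence it is an
injective map over `X`, an open embedding, and its range is clopen. The whole argument uses `j`
through these facts alone.

Composing the lift `γ` with `j` changes nothing else in a polygon: components, nodes, marked points
and the map `u` stay as they are. So stability is preserved (`IsStable.push`), gluing is strictly
respected (`PolygonData.push_glue`), and the map of fc-multicategories exists. It is injective on
1-cells because `j` is. On 2-cells, the conditions on an isomorphism that involve the lift are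
equalities of values of `γ`, and an injective `j` reflects them (`Iso.ofPush`); formal identities
and polygons cannot be confused. On 0-cells, a path in `L` that starts in the range of `j` stays
there, the range being clopen, and an embedding allows it to be pulled back
(`joined_of_isEmbedding`).

Fullness and factor-closedness both rest on one criterion: a polygon over `ι` comes from `ι'`
exactly if its lift takes all its values in the range of `j` (`mk_mem_range_push_iff`). The converse
direction composes the lift with the inverse of `j`, which is continuous on the range since `j` is
an open embedding.

For fullness, the evaluations place the lift in the range of `j` as the boundary leaves each marked
point. The lift is continuous along boundary arcs and crosses each boundary node continuously in the
direction of the orientation. The boundary is connected, so a single tour starting at `z₀` and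
returning to it carries membership in the clopen range to every special point
(`IsStable.liftsIn_of_marked`), and connectedness of each boundary circle carries it to all other
points (`IsStable.lift_mem_of_special`). No continuity is needed at the marked points, where the
lift may jump: there the hypothesis on the edges restarts the argument.

For factor-closedness, the lift of a glued polygon is the disjoint union of the lifts of its two
pieces, so it lies in the range of `j` if and only if both of them do (`liftsIn_glue`). Composites
with a formal identity are treated through their edges. -/

namespace FcModuli

/-! ### Images of maps of fc-multicategories -/

/-- The image of a map of fc-multicategories that is injective on 1-cells. -/
def FcMap.image {M M' : VDFcMulticategory.{u, v, w}} (F : FcMap M M')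
    (hF : Function.Injective F.onE) : FcSub M' where
  V₀ := Set.range F.onV
  E₀ := Set.range F.onE
  Cell₀ := Set.range F.onCell
  s_mem := by
    rintro _ ⟨e, rfl⟩
    exact ⟨_, (F.map_s e).symm⟩
  t_mem := by
    rintro _ ⟨e, rfl⟩
    exact ⟨_, (F.map_t e).symm⟩
  dom_mem := by
    rintro _ ⟨a, rfl⟩ e he
    rw [F.map_dom, List.mem_map] at he
    obtain ⟨e, -, rfl⟩ := he
    exact ⟨e, rfl⟩
  cod_mem := by
    rintro _ ⟨a, rfl⟩
    exact ⟨_, (F.map_cod a).symm⟩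
  unit_mem := by
    rintro _ ⟨e, rfl⟩
    exact ⟨_, F.map_unit e⟩
  comp_mem := by
    rintro _ i _ h ⟨a, rfl⟩ ⟨b, rfl⟩
    -- Two cells of the image may be composable in `M'` only because distinct edges of `M` were
    -- identified. Injectivity on 1-cells excludes this and makes the chosen preimages composable in
    -- `M`.
    have h' : (M.dom a)[i]? = some (M.cod b) := by
      rw [F.map_dom, F.map_cod, List.getElem?_map, Option.map_eq_some_iff] at h
      obtain ⟨e, he, he'⟩ := h
      rw [he, hF he']
    exact ⟨_, F.map_comp a i b h' h⟩

/-! ### Path components and clopen embeddings -/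

/-- The preimage of `S` in the connected unit interval is clopen and contains `0`. The conclusion
concerns every time `t`, not just the endpoint, because pulling a path back along an embedding
requires all its values to lie in the range. -/
theorem path_mem_of_isClopen {L : Type*} [TopologicalSpace L] {S : Set L} (hS : IsClopen S)
    {x y : L} (γ : Path x y) (hx : x ∈ S) (t : unitInterval) : γ t ∈ S := by
  have := (hS.preimage γ.continuous).eq_univ ⟨0, by simpa using hx⟩
  exact (this ▸ Set.mem_univ t : t ∈ γ ⁻¹' S)

theorem joined_mem_of_isClopen {L : Type*} [TopologicalSpace L] {S : Set L} (hS : IsClopen S)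
    {x y : L} (h : Joined x y) (hx : x ∈ S) : y ∈ S := by
  simpa using path_mem_of_isClopen hS h.somePath hx 1

/-- The path cannot leave the clopen range, and for an embedding a path inside the range is the
image of a continuous path. This is what makes the induced map on path components injective. -/
theorem joined_of_isEmbedding {L' L : Type*} [TopologicalSpace L'] [TopologicalSpace L]
    {j : L' → L} (hj : Topology.IsEmbedding j) (hr : IsClopen (Set.range j)) {x y : L'}
    (h : Joined (j x) (j y)) : Joined x y := by
  have : JoinedIn (j '' Set.univ) (j x) (j y) :=
    ⟨h.somePath, fun t => Set.image_univ ▸ path_mem_of_isClopen hr h.somePath ⟨x, rfl⟩ t⟩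
  exact ((hj.isInducing.joinedIn_image (Set.mem_univ x) (Set.mem_univ y)).1 this).joined

namespace PolygonData

/-! ### Polygons whose lift takes values in a subset -/

section LiftsIn

variable {X : Type u} {L : Type v}

/-- The lift of the boundary values takes its values in `S`. -/
def LiftsIn (D : PolygonData X L) (S : Set L) : Prop :=
  ∀ α ∈ D.disc, ∀ z, D.liftIn α z ∈ S ∧ D.liftOut α z ∈ S

/-- An isomorphism carries boundary circles of discs to boundary circles and matches the lifts
there, so the property depends only on the isomorphism class. This is needed because 2-cells are
classes, and membership in the image only provides an isomorphic representative. -/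
theorem LiftsIn.of_iso {D D' : PolygonData X L} {S : Set L} (hD : D.LiftsIn S) (g : D.Iso D') :
    D'.LiftsIn S := by
  intro α hα z
  obtain ⟨w, hw⟩ := g.symm.exists_bpt hα z
  have h := g.symm.lift_eq α hα z w hw
  rw [← h.1, ← h.2]
  exact hD _ ((g.symm.disc_iff α).2 hα) w

/-- Gluing forms the disjoint union of the components and keeps both lifts unchanged, including
their limits at the two points that become the node. The direction from left to right is the source
of factor-closedness. -/
theorem liftsIn_glue {A B : PolygonData X L} {i : ℕ} {hi : i < A.inputs.length} {S : Set L} :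
    (A.glue i hi B).LiftsIn S ↔ A.LiftsIn S ∧ B.LiftsIn S :=
  ⟨fun h => ⟨fun α hα z => h (.inl α) hα z, fun β hβ z => h (.inr β) hβ z⟩,
    fun h α hα z => match α, hα with
      | .inl α, hα => h.1 α hα z
      | .inr β, hβ => h.2 β hβ z⟩

theorem liftsIn_push {L' : Type w} (j : L' → L) (D : PolygonData X L') :
    (D.push j).LiftsIn (Set.range j) :=
  fun _ _ _ => ⟨⟨_, rfl⟩, ⟨_, rfl⟩⟩

end LiftsIn

/-! ### Change of the target of the lift -/

section Push

variable {X : Type u} {L : Type v} {L' : Type w}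

/-- Isomorphisms persist under composition of the lifts with a map. -/
def Iso.push {D D' : PolygonData X L} (g : D.Iso D') (j : L → L') :
    (D.push j).Iso (D'.push j) where
  f := g.f
  φ := g.φ
  moebius := g.moebius
  disc_iff := g.disc_iff
  image_domain := g.image_domain
  image_inner := g.image_inner
  adj_iff := g.adj_iff
  node_eq := g.node_eq
  out_eq := g.out_eq
  inputs_eq := g.inputs_eq
  map_eq := g.map_eq
  lift_eq α hα z z' h :=
    ⟨congrArg j (g.lift_eq α hα z z' h).1, congrArg j (g.lift_eq α hα z z' h).2⟩

/-- Composition of the lifts with a map that is injective on their values reflects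
isomorphisms. -/
def Iso.ofPush {D D' : PolygonData X L} {j : L → L'} {S : Set L} (hj : Set.InjOn j S)
    (hD : D.LiftsIn S) (hD' : D'.LiftsIn S) (g : (D.push j).Iso (D'.push j)) : D.Iso D' where
  f := g.f
  φ := g.φ
  moebius := g.moebius
  disc_iff := g.disc_iff
  image_domain := g.image_domain
  image_inner := g.image_inner
  adj_iff := g.adj_iff
  node_eq := g.node_eq
  out_eq := g.out_eq
  inputs_eq := g.inputs_eq
  map_eq := g.map_eq
  lift_eq α hα z z' h :=
    have hα' := (g.disc_iff α).2 hα
    ⟨hj (hD' _ hα' z').1 (hD α hα z).1 (g.lift_eq α hα z z' h).1,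
      hj (hD' _ hα' z').2 (hD α hα z).2 (g.lift_eq α hα z z' h).2⟩

/-- Gluing makes no use of the values of the lift, so the two operations commute strictly and no
isomorphism has to be chosen. -/
theorem push_glue (j : L → L') (A : PolygonData X L) (i : ℕ) (hi : i < A.inputs.length)
    (B : PolygonData X L) : (A.glue i hi B).push j = (A.push j).glue i hi (B.push j) := by
  have hs : ∀ (f : A.C → Circle → L) (g : B.C → Circle → L),
      (fun α z => j (Sum.elim f g α z)) =
        Sum.elim (fun α z => j (f α z)) fun β z => j (g β z) := fun f g => by
    funext α
    cases α <;> rfl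
  simp only [push, glue, PolygonData.mk.injEq, heq_eq_eq, true_and]
  refine ⟨rfl, rfl, ?_, rfl, hs _ _, hs _ _⟩
  funext α β
  cases α <;> cases β <;> rfl

/-- Composition of the lift with a right inverse of `j` and then with `j`. -/
def Iso.pushPush {D : PolygonData X L} {k : L → L'} {j : L' → L} {S : Set L}
    (hjk : ∀ x ∈ S, j (k x) = x) (hD : D.LiftsIn S) : ((D.push k).push j).Iso D where
  f := Equiv.refl _
  φ := fun _ => Equiv.refl _
  moebius := fun _ => ⟨1, fun z => by simp⟩
  disc_iff := fun _ => Iff.rfl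
  image_domain := fun α => by
    rw [Equiv.coe_refl, Set.image_id]; rfl
  image_inner := fun α => by
    rw [Equiv.coe_refl, Set.image_id]; rfl
  adj_iff := fun _ _ => Iff.rfl
  node_eq := fun _ _ _ => rfl
  out_eq := ⟨rfl, rfl⟩
  inputs_eq := List.forall₂_same.2 fun _ _ => ⟨rfl, rfl⟩
  map_eq := fun _ _ _ => rfl
  -- Only discs are tested here, and on them the lift has values in `S`. On spheres the recorded
  -- values are arbitrary, so the two data need not be equal, only isomorphic.
  lift_eq := fun α hα z z' h => by
    have : z' = z := bpt_injective h
    subst this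
    exact ⟨(hjk _ (hD α hα z').1).symm, (hjk _ (hD α hα z').2).symm⟩

end Push

/-! ### Stability under change of the lift, and propagation of the lift along the boundary -/

section Stable

variable {X : Type u} {L : Type v} {L' : Type w} [TopologicalSpace X] [TopologicalSpace L]
  [TopologicalSpace L'] {d : ℕ} [ChartedSpace (EuclideanSpace ℝ (Fin d)) X]
  [IsManifold (𝓡 d) ∞ X] {J : AlmostComplexStructure (d := d) X} {ι : L → X} {ι' : L' → X}

/-- Composition of the lift with a map over `X` that is continuous and injective on the values of
the lift preserves stable polygons. -/
theorem IsStable.push {D : PolygonData X L} (hD : D.IsStable J ι) {S : Set L} (hS : D.LiftsIn S)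
    {j : L → L'} (hj : ContinuousOn j S) (hinj : Set.InjOn j S) (hι : ∀ x ∈ S, ι' (j x) = ι x) :
    (D.push j).IsStable J ι' where
  finite := hD.finite
  tree := hD.tree
  out_disc := hD.out_disc
  inputs_disc := hD.inputs_disc
  node_bdry := hD.node_bdry
  node_inner := hD.node_inner
  node_inj := hD.node_inj
  marked_nodup := hD.marked_nodup
  marked_ne_node := hD.marked_ne_node
  bdry_special := hD.bdry_special
  order := hD.order
  continuous := hD.continuous
  holomorphic := hD.holomorphic
  holomorphic_infty := hD.holomorphic_infty
  map_node := hD.map_node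
  lift_map α hα z := ⟨(hι _ (hS α hα z).1).trans (hD.lift_map α hα z).1,
    (hι _ (hS α hα z).2).trans (hD.lift_map α hα z).2⟩
  lift_eq α hα z hz := congrArg j (hD.lift_eq α hα z hz)
  -- `j` is only assumed continuous on `S`. The one-sided limits are nevertheless transported,
  -- because the lift approaches them through points of `S`.
  lift_tendsto α hα z := by
    refine ⟨(hj _ (hS α hα z).1).tendsto.comp (tendsto_nhdsWithin_iff.2
      ⟨(hD.lift_tendsto α hα z).1, .of_forall fun θ => (hS α hα _).1⟩),
      (hj _ (hS α hα z).2).tendsto.comp (tendsto_nhdsWithin_iff.2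
      ⟨(hD.lift_tendsto α hα z).2, .of_forall fun θ => (hS α hα _).2⟩)⟩
  lift_node p q h hp hq := congrArg j (hD.lift_node p q h hp hq)
  -- Forgetting information in the lift could create automorphisms. Injectivity on `S` prevents it:
  -- every automorphism of the new polygon is one of `D`.
  stable := by
    have := hD.stable
    refine Finite.of_injective (Iso.ofPush hinj hS hS) fun g h e => ?_
    exact Iso.ext' (congrArg Iso.f e :) (congrArg Iso.φ e :)

/-- If the lift takes values in a clopen set at the special points of a disc, it does so on the
whole boundary of this disc. -/
theorem IsStable.lift_mem_of_special {D : PolygonData X L} (hD : D.IsStable J ι) {S : Set L}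
    (hS : IsClopen S) {α : D.C} (hα : α ∈ D.disc)
    (h : ∀ z, bpt z ∈ D.special α → D.liftIn α z ∈ S ∧ D.liftOut α z ∈ S) (z : Circle) :
    D.liftIn α z ∈ S ∧ D.liftOut α z ∈ S := by
  -- The two limits may differ at a special point, but there both lie in `S`; elsewhere they
  -- coincide. As far as membership in `S` is concerned, the lift therefore has no jumps.
  have hiff : ∀ z, D.liftIn α z ∈ S ↔ D.liftOut α z ∈ S := fun z => by
    by_cases hz : bpt z ∈ D.special α
    · exact iff_of_true (h z hz).1 (h z hz).2
    · rw [hD.lift_eq α hα z hz]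
  -- Stated for a general `T` in order to be applied to `S` and to its complement. The circle is
  -- parametrized by the connected line through `Circle.exp`.
  have hopen : ∀ T : Set L, IsOpen T → (∀ z, D.liftIn α z ∈ T ↔ D.liftOut α z ∈ T) →
      IsOpen {t : ℝ | D.liftIn α (Circle.exp t) ∈ T} := by
    intro T hT hiff
    rw [isOpen_iff_mem_nhds]
    intro t (ht : D.liftIn α (Circle.exp t) ∈ T)
    have ht' := (hiff _).1 ht
    have hl := (hD.lift_tendsto α hα (Circle.exp t)).1 (hT.mem_nhds ht)
    have hr := (hD.lift_tendsto α hα (Circle.exp t)).2 (hT.mem_nhds ht')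
    have h0 : ∀ᶠ θ in 𝓝 (0 : ℝ), D.liftIn α (Circle.exp θ * Circle.exp t) ∈ T := by
      -- A neighbourhood of `0` splits into its left part, governed by the limit of `liftIn`, its
      -- right part, governed by the limit of `liftOut`, and the point itself. On the right,
      -- membership is translated back to `liftIn`.
      rw [← nhdsNE_sup_pure, ← nhdsLT_sup_nhdsGT]
      refine Filter.eventually_sup.2 ⟨Filter.eventually_sup.2 ⟨hl, ?_⟩, by simpa using ht⟩
      exact Filter.Eventually.mono hr fun θ hθ => (hiff _).2 hθ
    have hs : Filter.Tendsto (fun s : ℝ => s - t) (𝓝 t) (𝓝 0) := by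
      simpa using (continuous_sub_right t).tendsto t
    filter_upwards [hs.eventually h0] with s hs
    rw [← Circle.exp_add] at hs
    simpa using hs
  have hclopen : IsClopen {t : ℝ | D.liftIn α (Circle.exp t) ∈ S} :=
    ⟨⟨hopen Sᶜ hS.1.isOpen_compl fun z => not_congr (hiff z)⟩, hopen S hS.2 hiff⟩
  -- The clopen set is non-empty because the boundary of every disc carries a special point.
  obtain ⟨z₀, hz₀⟩ := hD.bdry_special α hα
  obtain ⟨t₀, rfl⟩ := Circle.exp_surjective z₀
  have huniv := hclopen.eq_univ ⟨t₀, (h _ hz₀).1⟩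
  obtain ⟨t, rfl⟩ := Circle.exp_surjective z
  have : D.liftIn α (Circle.exp t) ∈ S := (huniv ▸ Set.mem_univ t :)
  exact ⟨this, (hiff _).1 this⟩

/-- If the lift leaves the marked points in a clopen set, it takes all its values in this set. -/
theorem IsStable.liftsIn_of_marked {D : PolygonData X L} (hD : D.IsStable J ι) {S : Set L}
    (hS : IsClopen S) (h : ∀ p ∈ D.out :: D.inputs, D.liftOut p.1 p.2 ∈ S) : D.LiftsIn S := by
  obtain ⟨l, -, hmem, hch, -⟩ := hD.order
  have hdisc : ∀ p ∈ D.out :: D.inputs, p.1 ∈ D.disc := by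
    intro p hp
    rcases List.mem_cons.1 hp with rfl | hp
    exacts [hD.out_disc, hD.inputs_disc p hp]
  -- One step of the tour. From a marked point the arc starts at `liftOut`, which is in `S` by
  -- hypothesis whatever happened before. At a node, the arriving limit on one disc equals the
  -- leaving limit on the other, where the next arc starts.
  have key : ∀ p q : D.C × Circle, D.Step p q → p.1 ∈ D.disc →
      (p ∈ D.out :: D.inputs ∨ D.liftIn p.1 p.2 ∈ S) → D.liftIn q.1 q.2 ∈ S := by
    intro p q hpq hp hpS
    by_cases hm : p ∈ D.out :: D.inputs
    · exact joined_mem_of_isClopen hS (hD.joined_arc hp (hD.step_marked hm hpq)) (h p hm)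
    · rcases hpq with ⟨hm', -⟩ | ⟨p', hg, hn⟩
      · exact absurd hm' hm
      · have hp' := hD.glued_disc hp hg
        refine joined_mem_of_isClopen hS (hD.joined_arc hp' hn) ?_
        rw [← hD.lift_node p p' hg hp hp']
        exact hpS.resolve_left hm
  have chain : ∀ (m : List (D.C × Circle)) (p : D.C × Circle), List.IsChain D.Step (p :: m) →
      (∀ q ∈ p :: m, q.1 ∈ D.disc) → (p ∈ D.out :: D.inputs ∨ D.liftIn p.1 p.2 ∈ S) →
      ∀ q ∈ m, D.liftIn q.1 q.2 ∈ S := by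
    intro m
    induction m with
    | nil => simp
    | cons r m ih =>
      intro p hc hd hp q hq
      rw [List.isChain_cons_cons] at hc
      have hr := key p r hc.1 (hd p (by simp)) hp
      rcases List.mem_cons.1 hq with rfl | hq
      · exact hr
      · exact ih r hc.2 (fun x hx => hd x (List.mem_cons_of_mem _ hx)) (.inr hr) q hq
  have hIn : ∀ α ∈ D.disc, ∀ z, bpt z ∈ D.special α → D.liftIn α z ∈ S := by
    intro α hα z hz
    have hq : (α, z) ∈ D.out :: l := (hmem (α, z)).2 ⟨hα, hz⟩
    -- The tour returns to `D.out` at its end. This last step yields the arriving limit at `z₀`,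
    -- about which the beginning of the tour says nothing.
    refine chain (l ++ [D.out]) D.out hch (fun q hq => ?_) (.inl (by simp)) (α, z) ?_
    · refine ((hmem q).1 ?_).1
      simp only [List.mem_cons, List.mem_append, List.not_mem_nil, or_false] at hq ⊢
      tauto
    · simp only [List.mem_cons, List.mem_append, List.not_mem_nil, or_false] at hq ⊢
      tauto
  refine fun α hα z => hD.lift_mem_of_special hS hα (fun z hz => ⟨hIn α hα z hz, ?_⟩) z
  -- It remains to treat the leaving limits. At a node, which is not interior since it lies on the
  -- circle, this limit is the arriving limit on the adjacent disc; at a marked point it is the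
  -- hypothesis.
  rcases hz with ⟨β, hadj, hz⟩ | ⟨p, hp, rfl, hz⟩
  · have hβ : β ∈ D.disc := by
      by_contra hβ
      have := hD.node_inner α β hadj fun h => hβ h.2
      rw [← hz] at this
      exact bpt_notMem_openDisc _ (this hα)
    obtain ⟨w, hw⟩ := hD.node_bdry β α hadj.symm hβ hα
    rw [← hD.lift_node (β, w) (α, z) ⟨hadj.symm, hw.symm, hz⟩ hβ hα]
    exact hIn β hβ w (.inl ⟨α, hadj.symm, hw.symm⟩)
  · rw [bpt_injective hz]
    exact h p hp

end Stable

end PolygonData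

/-! ### The map of moduli fc-multicategories induced by a clopen embedding -/

section Edge

variable {X : Type u} {L L' : Type v} {ι : L → X} {ι' : L' → X} {j : L' → L}

/-- The map of fibre products induced by a map over `X`. -/
def Edge.push (hι : ∀ x, ι (j x) = ι' x) (e : Edge ι') : Edge ι :=
  ⟨(j e.1.1, j e.1.2), by simpa only [hι] using e.2⟩

theorem Edge.push_injective (hι : ∀ x, ι (j x) = ι' x) (hj : Function.Injective j) :
    Function.Injective (Edge.push hι) := by
  rintro ⟨⟨a, b⟩, h⟩ ⟨⟨a', b'⟩, h'⟩ e
  have e := congrArg Subtype.val e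
  simp only [Edge.push, Prod.mk.injEq] at e
  exact Subtype.ext (Prod.ext (hj e.1) (hj e.2))

end Edge

section Induced

variable {X : Type u} {L L' : Type v} [TopologicalSpace X] [TopologicalSpace L]
  [TopologicalSpace L'] {d : ℕ} [ChartedSpace (EuclideanSpace ℝ (Fin d)) X]
  [IsManifold (𝓡 d) ∞ X] {J : AlmostComplexStructure (d := d) X} {ι : L → X} {ι' : L' → X}
  {j : L' → L}

namespace StablePolygon

/-- The stable polygon obtained by composition of the lift with an injective continuous map. -/
def push (hc : Continuous j) (hj : Function.Injective j) (hι : ∀ x, ι (j x) = ι' x)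
    (P : StablePolygon J ι') : StablePolygon J ι :=
  ⟨P.1.push j, P.2.push (S := Set.univ) (fun _ _ _ => ⟨trivial, trivial⟩) hc.continuousOn
    hj.injOn fun x _ => hι x⟩

variable (hc : Continuous j) (hj : Function.Injective j) (hι : ∀ x, ι (j x) = ι' x)

/-- One implication makes the map on isomorphism classes well defined; the other, which uses
injectivity of `j`, makes it injective. -/
theorem push_equiv_iff {P Q : StablePolygon J ι'} :
    push (J := J) hc hj hι P ≈ push hc hj hι Q ↔ P ≈ Q :=
  ⟨fun ⟨g⟩ => ⟨.ofPush (S := Set.univ) hj.injOn (fun _ _ _ => ⟨trivial, trivial⟩)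
    (fun _ _ _ => ⟨trivial, trivial⟩) g⟩, fun ⟨g⟩ => ⟨g.push j⟩⟩

theorem dom_push (P : StablePolygon J ι') :
    (push hc hj hι P).dom = P.dom.map (Edge.push hι) := by
  apply List.map_injective_iff.2 Subtype.val_injective
  rw [map_dom, List.map_map]
  have : Subtype.val ∘ Edge.push hι = (Prod.map j j) ∘ Subtype.val := rfl
  rw [this, ← List.map_map, map_dom, List.map_map]
  rfl

theorem push_glue (P : StablePolygon J ι') (i : ℕ) (Q : StablePolygon J ι')
    (h : P.dom[i]? = some Q.cod)
    (h' : (push hc hj hι P).dom[i]? = some (push hc hj hι Q).cod) :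
    push hc hj hι (P.glue i Q h) = (push hc hj hι P).glue i (push hc hj hι Q) h' :=
  Subtype.ext (PolygonData.push_glue j _ _ _ _)

end StablePolygon

/-- The map on 2-cells induced by an injective continuous map over `X`. -/
def ModuliCell.push (hc : Continuous j) (hj : Function.Injective j) (hι : ∀ x, ι (j x) = ι' x) :
    ModuliCell J ι' → ModuliCell J ι
  | unit e => unit (e.push hι)
  | polygon a => polygon (a.map (StablePolygon.push hc hj hι)
      fun _ _ => (StablePolygon.push_equiv_iff hc hj hι).2)

/-- Identities and polygons belong to different constructors, so cells need only be compared within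
one kind. For polygons, isomorphisms are reflected. -/
theorem ModuliCell.push_injective (hc : Continuous j) (hj : Function.Injective j)
    (hι : ∀ x, ι (j x) = ι' x) :
    Function.Injective (ModuliCell.push (J := J) hc hj hι) := by
  rintro (e | a) (e' | b) h
  · exact congrArg unit (Edge.push_injective hι hj (ModuliCell.unit.inj h))
  · cases h
  · cases h
  · induction a using Quotient.inductionOn with | _ P
    induction b using Quotient.inductionOn with | _ Q
    exact congrArg polygon (Quotient.sound
      ((StablePolygon.push_equiv_iff hc hj hι).1 (Quotient.exact (ModuliCell.polygon.inj h))))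

/-- The map of moduli fc-multicategories induced by an injective continuous map over `X`. -/
noncomputable def moduliMap (J : AlmostComplexStructure (d := d) X) (hc : Continuous j)
    (hj : Function.Injective j) (hι : ∀ x, ι (j x) = ι' x) :
    FcMap (moduli J ι') (moduli J ι) where
  onV := Quotient.map j fun _ _ h => h.map hc
  onE := Edge.push hι
  onCell := ModuliCell.push hc hj hι
  map_s _ := rfl
  map_t _ := rfl
  map_dom := by
    rintro (e | a)
    · rfl
    · induction a using Quotient.inductionOn with | _ P
      exact StablePolygon.dom_push hc hj hι P
  map_cod := by
    rintro (e | a)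
    · rfl
    · induction a using Quotient.inductionOn with | _ P
      rfl
  map_unit _ := rfl
  map_comp := by
    rintro (e | a) i (e' | b) h h'
    · rfl
    · rfl
    · rfl
    · induction a using Quotient.inductionOn with | _ P
      induction b using Quotient.inductionOn with | _ Q
      -- Composition is defined on representatives chosen by `Quotient.out`, which the map does not
      -- respect. `mk_comp` replaces them by `P`, `Q` and their images, for which the equality is
      -- strict.
      refine (congrArg (ModuliCell.push hc hj hι) (ModuliCell.mk_comp P i Q h)).trans ?_
      refine Eq.trans ?_ (ModuliCell.mk_comp (P.push hc hj hι) i (Q.push hc hj hι) h').symm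
      exact congrArg ModuliCell.mk (StablePolygon.push_glue hc hj hι P i Q h h')

theorem isInducedBy_moduliMap (hc : Continuous j) (hj : Function.Injective j)
    (hι : ∀ x, ι (j x) = ι' x) : IsInducedBy (moduliMap J hc hj hι) j where
  onV_eq _ := rfl
  onE_eq _ := rfl
  onCell_eq P := ⟨(P.push hc hj hι).2, rfl⟩

/-- Injectivity of `j` alone would not suffice, since path components could merge in `L`; the clopen
range rules this out. -/
theorem moduliMap_onV_injective (he : Topology.IsEmbedding j) (hr : IsClopen (Set.range j))
    (hι : ∀ x, ι (j x) = ι' x) :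
    Function.Injective (moduliMap J he.continuous he.injective hι).onV := by
  intro a b h
  induction a using Quotient.inductionOn with | _ x
  induction b using Quotient.inductionOn with | _ y
  exact mk_eq_of_joined (joined_of_isEmbedding he hr (Quotient.exact h))

/-- A stable polygon comes from `L'` exactly if its lift takes values in the image of `L'`. -/
theorem mk_mem_range_push_iff (he : Topology.IsOpenEmbedding j) (hι : ∀ x, ι (j x) = ι' x)
    (P : StablePolygon J ι) :
    ModuliCell.mk P ∈ Set.range (ModuliCell.push (J := J) he.continuous he.injective hι) ↔
      P.1.LiftsIn (Set.range j) := by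
  constructor
  · rintro ⟨e | a, h⟩
    · cases h
    · induction a using Quotient.inductionOn with | _ Q
      obtain ⟨g⟩ := Quotient.exact (ModuliCell.polygon.inj h)
      exact (PolygonData.liftsIn_push j Q.1).of_iso g
  · intro hP
    -- The lift has a value at `z₀`, so `L'` is non-empty, as `Function.invFun` demands.
    obtain ⟨x₀, -⟩ := (hP _ P.2.out_disc P.1.out.2).1
    have : Nonempty L' := ⟨x₀⟩
    have hk : ∀ x ∈ Set.range j, j (Function.invFun j x) = x := fun x hx => Function.invFun_eq hx
    have hcont : ContinuousOn (Function.invFun j) (Set.range j) := by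
      rintro _ ⟨x, rfl⟩
      refine ContinuousAt.continuousWithinAt ?_
      -- For an open embedding, continuity at `j x` can be tested after composition with `j`, and
      -- this composite is the identity.
      rw [← he.continuousAt_iff, Function.invFun_comp he.injective]
      exact continuousAt_id
    have hinj : Set.InjOn (Function.invFun j) (Set.range j) := fun x hx y hy h => by
      rw [← hk x hx, ← hk y hy, h]
    refine ⟨ModuliCell.mk ⟨P.1.push (Function.invFun j), P.2.push (ι' := ι') hP hcont hinj
      fun x hx => by rw [← hι, hk x hx]⟩, ?_⟩
    exact congrArg ModuliCell.polygon (Quotient.sound ⟨.pushPush hk hP⟩)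

/-! ### Fullness and factor-closedness of the image -/

theorem isFull_image_moduliMap (he : Topology.IsOpenEmbedding j) (hr : IsClopen (Set.range j))
    (hι : ∀ x, ι (j x) = ι' x) :
    ((moduliMap J he.continuous he.injective hι).image
      (Edge.push_injective hι he.injective)).IsFull := by
  rintro (e | a) hdom hcod
  · obtain ⟨e', rfl⟩ := hcod
    exact ⟨.unit e', rfl⟩
  · induction a using Quotient.inductionOn with | _ P
    refine (mk_mem_range_push_iff he hι P).2 (P.2.liftsIn_of_marked hr fun p hp => ?_)
    -- The leaving limit is the first entry of the edge at `z₀` and the second entry of the edge at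
    -- an input, by the opposite conventions for `evOut` and `evIn`.
    rcases List.mem_cons.1 hp with rfl | hp
    · obtain ⟨e, he⟩ := hcod
      exact ⟨_, congrArg (fun e : Edge ι => e.1.1) he⟩
    · obtain ⟨e, he⟩ := hdom _ (List.mem_pmap.2 ⟨p, hp, rfl⟩)
      exact ⟨_, congrArg (fun e : Edge ι => e.1.2) he⟩

theorem isFactorClosed_image_moduliMap (he : Topology.IsOpenEmbedding j)
    (hι : ∀ x, ι (j x) = ι' x) :
    ((moduliMap J he.continuous he.injective hι).image
      (Edge.push_injective hι he.injective)).IsFactorClosed := by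
  rintro (e | a) i b h hab
  -- A composite with an identity on the outside is `b` itself. The identity belongs to the output
  -- edge of `b`, which lies in the image because `b` does.
  · refine ⟨?_, hab⟩
    obtain ⟨hi, h⟩ := List.getElem?_eq_some_iff.1 h
    obtain rfl : i = 0 := by simpa [moduli, ModuliCell.dom] using hi
    obtain ⟨e', he'⟩ := FcSub.cod_mem _ b hab
    exact ⟨.unit e', congrArg ModuliCell.unit (he'.trans h.symm)⟩
  · rcases b with e | b
    -- Here the composite is the outer polygon, and the identity belongs to one of its input edges.
    · refine ⟨hab, ?_⟩
      obtain ⟨e', he'⟩ := FcSub.dom_mem _ _ hab e (List.mem_of_getElem? h)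
      exact ⟨.unit e', congrArg ModuliCell.unit he'⟩
    · induction a using Quotient.inductionOn with | _ P
      induction b using Quotient.inductionOn with | _ Q
      have hPQ : ModuliCell.mk (P.glue i Q h) ∈
          Set.range (ModuliCell.push (J := J) he.continuous he.injective hι) := by
        rw [← ModuliCell.mk_comp P i Q h]
        exact hab
      have := PolygonData.liftsIn_glue.1 ((mk_mem_range_push_iff he hι _).1 hPQ)
      exact ⟨(mk_mem_range_push_iff he hι P).2 this.1, (mk_mem_range_push_iff he hι Q).2 this.2⟩

end Induced

/-! ### Subfamilies -/

theorem Total.isOpenEmbedding_incl {X : Type u} [TopologicalSpace X] {A B : Type} (L : B → Set X)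
    {f : A → B} (hf : Function.Injective f) : Topology.IsOpenEmbedding (Total.incl L f) :=
  (Topology.isOpenEmbedding_sigmaMap (τ := fun b => L b) (f₂ := fun a (x : L (f a)) => x) hf).2
    fun _ => Topology.IsOpenEmbedding.id

/-- The range is the preimage of a set of indices, and every such preimage is open in a topological
disjoint union. The members of the family may intersect in `X`; it is in their disjoint union that
they are separated. -/
theorem Total.isClopen_range_incl {X : Type u} [TopologicalSpace X] {A B : Type} (L : B → Set X)
    (f : A → B) : IsClopen (Set.range (Total.incl L f)) := by
  have : Set.range (Total.incl L f) = Sigma.fst ⁻¹' Set.range f := by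
    ext ⟨b, x⟩
    constructor
    · rintro ⟨⟨a, y⟩, h⟩
      exact ⟨a, congrArg Sigma.fst h⟩
    · rintro ⟨a, rfl⟩
      exact ⟨⟨a, x⟩, rfl⟩
  rw [this]
  exact ⟨⟨isOpen_sigma_fst_preimage (Set.range f)ᶜ⟩, isOpen_sigma_fst_preimage _⟩

theorem Index.incl_injective {M N : ℕ∞} (h : M ≤ N) : Function.Injective (Index.incl h) :=
  fun _ _ e => Subtype.ext (Subtype.mk.inj e)

end FcModuli

/-! ### The proposition for families of Lagrangians -/

theorem mainTheorem7 {n : ℕ} {X : Type u} [TopologicalSpace X] [T2Space X]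
    [SecondCountableTopology X] [CompactSpace X]
    [ChartedSpace (EuclideanSpace ℝ (Fin (2 * n))) X] [IsManifold (𝓡 (2 * n)) ∞ X]
    (Ω : FcModuli.SymplecticForm (d := 2 * n) X)
    (J : FcModuli.AlmostComplexStructure (d := 2 * n) X) (_hJ : J.IsTame Ω)
    (N : ℕ∞) (L : FcModuli.Index N → Set X)
    (_hLag : ∀ v, Ω.IsLagrangian (L v)) (_hconn : ∀ v, IsConnected (L v))
    (_htrans : ∀ v w, v ≠ w → FcModuli.Transverse (2 * n) (L v) (L w))
    (m : ℕ) (hm : (m : ℕ∞) < N) :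
    ∃ F : FcModuli.FcMap
        (FcModuli.moduli J
          (FcModuli.Total.toBase fun v : FcModuli.Index m => L (FcModuli.Index.incl hm.le v)))
        (FcModuli.moduli J (FcModuli.Total.toBase L)),
      FcModuli.IsInducedBy F (FcModuli.Total.incl L (FcModuli.Index.incl hm.le)) ∧
      Function.Injective F.onV ∧ Function.Injective F.onE ∧ Function.Injective F.onCell ∧
      ∃ S : FcModuli.FcSub (FcModuli.moduli J (FcModuli.Total.toBase L)),
        S.V₀ = Set.range F.onV ∧ S.E₀ = Set.range F.onE ∧ S.Cell₀ = Set.range F.onCell ∧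
        S.IsFull ∧ S.IsFactorClosed := by
  have he := FcModuli.Total.isOpenEmbedding_incl L (FcModuli.Index.incl_injective hm.le)
  have hr := FcModuli.Total.isClopen_range_incl L (FcModuli.Index.incl hm.le)
  have hι : ∀ x, FcModuli.Total.toBase L (FcModuli.Total.incl L (FcModuli.Index.incl hm.le) x) =
      FcModuli.Total.toBase (fun v : FcModuli.Index m => L (FcModuli.Index.incl hm.le v)) x :=
    fun _ => rfl
  refine ⟨FcModuli.moduliMap J he.continuous he.injective hι,
    FcModuli.isInducedBy_moduliMap _ _ _,
    FcModuli.moduliMap_onV_injective he.isEmbedding hr _,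
    FcModuli.Edge.push_injective hι he.injective,
    FcModuli.ModuliCell.push_injective _ he.injective hι,
    FcModuli.FcMap.image _ (FcModuli.Edge.push_injective hι he.injective), rfl, rfl, rfl,
    FcModuli.isFull_image_moduliMap he hr hι, FcModuli.isFactorClosed_image_moduliMap he hι⟩
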